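/- Let $u_0\in L^\infty(\mathbb R)$ and let $u\in L^\infty(\mathbb R\times\mathbb R_+)$, $\mathbb R_+=[0,\infty)$, be the entropy solution of Burgers' equation $$\partial_t u+\partial_x\Bigl(\frac{u^2}{2}\Bigr)=0,\qquad u(\cdot,0)=u_0 ,$$ that is, with $f(v)=v^2/2$, $u$ is a weak solution (in the sense of distributions, with initial data $u_0$), and for every convex $\eta:\mathbb R\to\mathbb R$, every $q$ with $q'=\eta' f'$ (in integrated form) and every $0\le\varphi\in C_c^\infty(\mathbb R\times\mathbb R_+)$, $$\int_{\mathbb R_+}\int_{\mathbb R}\eta(u)\,\partial_t\varphi+q(u)\,\partial_x\varphi\,dx\,dt+\int_{\mathbb R}\eta(u_0(x))\,\varphi(x,0)\,dx\ge 0 .$$ For $c\in\mathbb R$ let $a_c$ be the velocity field $a_c(x,t)=\frac{f(u(x,t))-f(c)}{u(x,t)-c}$ if $u(x,t)\ne c$ and $a_c(x,t)=f'(c)$ otherwise, that is, $a_c=\frac{u+c}{2}$. A Filippov solution of $\dot x_t=a_c(x_t,t)$ for $t>s$, $x_s=x$, is a locally absolutely continuous function $t\mapsto x_t$ on $[s,\infty)$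 with $x_s=x$ and, for almost every $t>s$, $$\lim_{\delta\downarrow0}\operatorname*{ess\,inf}_{|y-x_t|<\delta}a_c(y,t)\;\le\;\dot x_t\;\le\;\lim_{\delta\downarrow0}\operatorname*{ess\,sup}_{|y-x_t|<\delta}a_c(y,t).$$ Then for every $c\in\mathbb R$ this ODE is well-posed in the Filippov sense: for every $x\in\mathbb R$ and $s\ge0$ there is exactly one Filippov solution $t\mapsto X_t(x,s)$ starting from $x$ at time $s$, and the flow $(t,x,s)\mapsto X_t(x,s)$ is continuous on $\{(t,x,s):0\le s\le t\}$. Moreover, if $x_t$ and $y_t$ are Filippov solutions with $x_0=x$ and $y_0=y$, then $$|y_t-x_t|\le|y-x|+2\sqrt{\|u_0\|_{L^\infty}\,|y-x|\,t}\qquad\text{for all }t\ge0 .$$ -/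

import Mathlib

open MeasureTheory Set Filter
open scoped ENNReal ContDiff

noncomputable section

/-- The flux of Burgers' equation `∂ₜ u + ∂ₓ (u² / 2) = 0`. -/
def burgersFlux (v : ℝ) : ℝ := v ^ 2 / 2

/-- The difference quotient `A(v, c) = (f v - f c) / (v - c)`, extended by `f' c` at `v = c`. -/
def secantSpeed (f : ℝ → ℝ) (v c : ℝ) : ℝ :=
  if v = c then deriv f c else (f v - f c) / (v - c)

/-- The velocity field `a_c(x, t) = A(u(x, t), c)`. -/
def particleVelocity (f : ℝ → ℝ) (u : ℝ → ℝ → ℝ) (c : ℝ) : ℝ → ℝ → ℝ :=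
  fun x t => secantSpeed f (u x t) c

/-- For Burgers' equation the velocity field is `(u + c) / 2`. -/
theorem particleVelocity_burgersFlux (u : ℝ → ℝ → ℝ) (c x t : ℝ) :
    particleVelocity burgersFlux u c x t = (u x t + c) / 2 := by
  unfold particleVelocity secantSpeed
  split_ifs with h
  · have h1 : HasDerivAt burgersFlux ((2 : ℕ) * c ^ (2 - 1) / 2) c :=
      (hasDerivAt_pow 2 c).div_const 2
    rw [h1.deriv, h]
    norm_num
  · have h2 : u x t - c ≠ 0 := sub_ne_zero.mpr h
    unfold burgersFlux
    field_simp
    ring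

/-- Test functions `φ(x, t)` in `C_c^∞(ℝ × [0, ∞))`: restrictions to `t ≥ 0` of smooth, compactly
supported functions on the plane. They need not vanish at `t = 0`. -/
structure IsTestFunction (φ : ℝ → ℝ → ℝ) : Prop where
  smooth : ContDiff ℝ ∞ (fun p : ℝ × ℝ => φ p.1 p.2)
  compactSupport : HasCompactSupport (fun p : ℝ × ℝ => φ p.1 p.2)

/-- The functional
`∫_{t > 0} ∫_ℝ η(u) ∂ₜφ + q(u) ∂ₓφ dx dt + ∫_ℝ η(u₀(x)) φ(x, 0) dx`. -/
def balance (η q : ℝ → ℝ) (u₀ : ℝ → ℝ) (u φ : ℝ → ℝ → ℝ) : ℝ :=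
  (∫ t in Ioi (0 : ℝ), ∫ x : ℝ,
      (η (u x t) * deriv (fun r => φ x r) t + q (u x t) * deriv (fun y => φ y t) x))
    + ∫ x : ℝ, η (u₀ x) * φ x 0

/-- `u ∈ L^∞(ℝ × ℝ₊)` solves `∂ₜ u + ∂ₓ f(u) = 0`, `u(·, 0) = u₀`, in the sense of
distributions. -/
structure IsWeakSolution (f : ℝ → ℝ) (u₀ : ℝ → ℝ) (u : ℝ → ℝ → ℝ) : Prop where
  memLp_top : MemLp (fun p : ℝ × ℝ => u p.1 p.2) ∞ (volume.restrict (univ ×ˢ Ioi (0 : ℝ)))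
  weak : ∀ φ, IsTestFunction φ → balance id f u₀ u φ = 0

/-- Entropy pairs: `η` is convex and `q` is a primitive of `η' f'`. Since a convex function is
differentiable off a countable set only, `q' = η' f'` is meant in integrated form; this includes
the pairs `η(v) = |v - k|`, `q(v) = sgn(v - k) (f v - f k)`. -/
structure IsEntropyPair (f η q : ℝ → ℝ) : Prop where
  convex : ConvexOn ℝ univ η
  primitive : ∀ v w : ℝ, q w - q v = ∫ r in v..w, deriv η r * deriv f r

/-- Entropy solutions: weak solutions that satisfy the entropy inequality for all entropy pairs
and all nonnegative test functions. -/
structure IsEntropySolution (f : ℝ → ℝ) (u₀ : ℝ → ℝ) (u : ℝ → ℝ → ℝ) : Prop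
    extends IsWeakSolution f u₀ u where
  entropy : ∀ η q, IsEntropyPair f η q → ∀ φ, IsTestFunction φ →
    (∀ x t : ℝ, 0 ≤ t → 0 ≤ φ x t) → 0 ≤ balance η q u₀ u φ

/-- `lim_{δ ↓ 0} ess inf_{|y - x| < δ} a(y, t)`; the essential infimum increases as `δ`
decreases, so that the limit is a supremum. -/
def lowerEnvelope (a : ℝ → ℝ → ℝ) (x t : ℝ) : EReal :=
  ⨆ δ : {δ : ℝ // 0 < δ},
    essInf (fun y => (a y t : EReal)) (volume.restrict (Ioo (x - δ) (x + δ)))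

/-- `lim_{δ ↓ 0} ess sup_{|y - x| < δ} a(y, t)`; the essential supremum decreases as `δ`
decreases, so that the limit is an infimum. -/
def upperEnvelope (a : ℝ → ℝ → ℝ) (x t : ℝ) : EReal :=
  ⨅ δ : {δ : ℝ // 0 < δ},
    essSup (fun y => (a y t : EReal)) (volume.restrict (Ioo (x - δ) (x + δ)))

/-- `ξ` is a Filippov solution on `[s, ∞)` of `ξ' = a(ξ, t)`, `ξ(s) = x`: it is absolutely
continuous on compact intervals and satisfies the differential inclusion at almost every time.
Only the values of `ξ` on `[s, ∞)` matter. -/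
structure IsFilippovSolution (a : ℝ → ℝ → ℝ) (s x : ℝ) (ξ : ℝ → ℝ) : Prop where
  initial : ξ s = x
  absolutelyContinuous : ∀ T, s ≤ T → AbsolutelyContinuousOnInterval ξ s T
  inclusion : ∀ᵐ t ∂(volume.restrict (Ioi s)), DifferentiableAt ℝ ξ t ∧
    lowerEnvelope a (ξ t) t ≤ ((deriv ξ t : ℝ) : EReal) ∧
    ((deriv ξ t : ℝ) : EReal) ≤ upperEnvelope a (ξ t) t

/-- Well-posedness of `ξ' = a(ξ, t)` in the Filippov sense, for all starting points `(x, s)` with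
`s ≥ 0`: existence, uniqueness, and continuity of the flow `(t, x, s) ↦ X_t(x, s)`. -/
structure IsFilippovWellPosed (a : ℝ → ℝ → ℝ) : Prop where
  exists_solution : ∀ s x : ℝ, 0 ≤ s → ∃ ξ, IsFilippovSolution a s x ξ
  unique : ∀ s x : ℝ, 0 ≤ s → ∀ ξ ζ, IsFilippovSolution a s x ξ → IsFilippovSolution a s x ζ →
    EqOn ξ ζ (Ici s)
  continuous_flow : ∀ X : ℝ → ℝ → ℝ → ℝ,
    (∀ s x : ℝ, 0 ≤ s → IsFilippovSolution a s x (fun t => X t x s)) →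
    ContinuousOn (fun p : ℝ × ℝ × ℝ => X p.1 p.2.1 p.2.2) {p | 0 ≤ p.2.2 ∧ p.2.2 ≤ p.1}

end

/-!
The weak formulation says that the 1-form `u dx - (u² / 2) dt` is closed, so that `u = ∂ₓU` for a
Lipschitz potential `U` with `∂ₜU + (∂ₓU)² / 2 = 0` almost everywhere
(`WeaklyClosed.exists_potential`). Everything is read off from `U`.

*From the entropy inequality to Oleĭnik's estimate.* Testing the entropy inequality for
`η(v) = (v - p)² / 2 + A` with a function of `ψ - U`, where `ψ` touches `U` from below with
`∂ₓψ = p`, shows that `U` is a viscosity supersolution of the Hamilton–Jacobi equation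
(`IsPotential.viscosity_supersolution`). Hence smooth subsolutions that start below `U` stay below it
(`IsPotential.comparison`). Since the Hamiltonian is convex, mollifications `S` of `U` are smooth
subsolutions, and so are their translates and the sheared averages
`l S(x + m k t, t) + m S(x - l k t, t) - l m k² t / 2` with `l + m = 1`. Comparison of these with `U`
yields that `U(·, t)` is `M`-Lipschitz with `M = ‖u₀‖_∞` and that `U(·, t) - x² / (2 t)` is concave
(`IsPotential.abs_sub_le`, `IsPotential.concaveOn`), that is, `|u| ≤ M` and `∂ₓu ≤ 1 / t`.

*Stability and uniqueness.* The Filippov velocity of `(u + c) / 2` has one-sided Lipschitz constant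
`1 / (2 t)` in `x` and oscillation at most `M`. For the distance `D` of two Filippov solutions it
follows that `D² / t` does not increase and that `D` grows at most with rate `M`. The second bound up
to the time `D(0) / M` and the first one afterwards give `D(t) ≤ D(0) + 2 √(M D(0) t)`
(`IsOleinikPotential.stability`). The same argument between times `s ≤ t` gives uniqueness and, with
the Lipschitz bound for trajectories, continuity of the flow.

*Existence.* Replacing `u` by a central difference quotient of `U` gives an equation that the
Picard–Lindelöf theorem solves. A limit of the solutions satisfies the Filippov inclusion because
secant slopes of the concave functions `U(·, t) - x² / (2 t)` are monotone, so that the approximate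
velocities near a point are controlled by difference quotients of `U` on fixed intervals on either
side of it, and these are continuous in time (`two_mul_deriv_sub_le_secant`).
-/

open scoped Topology NNReal

/-! ### Mollification in the plane -/

/-- The mollification of `g : ℝ × ℝ → ℝ` by the normalised bump function `φ`. -/
noncomputable def mollify (φ : ContDiffBump (0 : ℝ × ℝ)) (g : ℝ × ℝ → ℝ) (P : ℝ × ℝ) : ℝ :=
  ∫ Q, φ.normed volume Q * g (P - Q)

theorem mollify_eq_convolution (φ : ContDiffBump (0 : ℝ × ℝ)) (g : ℝ × ℝ → ℝ) :
    mollify φ g = convolution (φ.normed volume) g (ContinuousLinearMap.lsmul ℝ ℝ) volume := rfl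

theorem contDiff_mollify (φ : ContDiffBump (0 : ℝ × ℝ)) {g : ℝ × ℝ → ℝ}
    (hg : LocallyIntegrable g) : ContDiff ℝ ∞ (mollify φ g) := by
  rw [mollify_eq_convolution]
  exact φ.hasCompactSupport_normed.contDiff_convolution_left _ φ.contDiff_normed hg

theorem fderiv_mollify_apply (φ : ContDiffBump (0 : ℝ × ℝ)) {g : ℝ × ℝ → ℝ}
    (hg : LocallyIntegrable g) (P v : ℝ × ℝ) :
    fderiv ℝ (mollify φ g) P v = ∫ Q, fderiv ℝ (φ.normed volume) (P - Q) v * g Q := by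
  have h := φ.hasCompactSupport_normed.hasFDerivAt_convolution_right
    (ContinuousLinearMap.lsmul ℝ ℝ : ℝ →L[ℝ] ℝ →L[ℝ] ℝ).flip hg (φ.contDiff_normed (n := 1)
      (μ := (volume : Measure (ℝ × ℝ)))) P
  rw [convolution_flip] at h
  rw [mollify_eq_convolution, h.fderiv, convolution_precompR_apply _ hg
    (φ.hasCompactSupport_normed.fderiv ℝ)
    ((φ.contDiff_normed (n := 1)).continuous_fderiv one_ne_zero)]
  rfl

theorem locallyIntegrable_of_abs_le {X : Type*} [TopologicalSpace X] [MeasurableSpace X]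
    {μ : Measure X} [IsLocallyFiniteMeasure μ] {g : X → ℝ} (hm : Measurable g) {L : ℝ}
    (hL : ∀ P, |g P| ≤ L) : LocallyIntegrable g μ := by
  refine (locallyIntegrable_const L).mono hm.aestronglyMeasurable (ae_of_all _ fun P => ?_)
  rw [Real.norm_eq_abs]
  exact (hL P).trans (le_abs_self L)

theorem integrable_normed_mul (φ : ContDiffBump (0 : ℝ × ℝ)) {g : ℝ × ℝ → ℝ} (hm : Measurable g)
    {L : ℝ} (hL : ∀ P, |g P| ≤ L) : Integrable fun Q => φ.normed volume Q * g Q :=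
  φ.integrable_normed.mul_bdd (c := L) hm.aestronglyMeasurable (ae_of_all _ fun P => hL P)

theorem abs_mollify_le (φ : ContDiffBump (0 : ℝ × ℝ)) {g : ℝ × ℝ → ℝ}
    {L : ℝ} (hL : ∀ P, |g P| ≤ L) (P : ℝ × ℝ) : |mollify φ g P| ≤ L := by
  have h1 : |mollify φ g P| ≤ ∫ Q, φ.normed volume Q * L := by
    rw [← Real.norm_eq_abs]
    refine norm_integral_le_of_norm_le (φ.integrable_normed.mul_const L) (ae_of_all _ fun Q => ?_)
    rw [norm_mul, Real.norm_of_nonneg (φ.nonneg_normed Q)]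
    exact mul_le_mul_of_nonneg_left (hL _) (φ.nonneg_normed Q)
  rwa [integral_mul_const, φ.integral_normed, one_mul] at h1

theorem mollify_comm (φ ψ : ContDiffBump (0 : ℝ × ℝ)) {g : ℝ × ℝ → ℝ} (hm : Measurable g)
    {L : ℝ} (hL : ∀ P, |g P| ≤ L) : mollify φ (mollify ψ g) = mollify ψ (mollify φ g) := by
  funext P
  have h : Integrable (Function.uncurry fun Q R : ℝ × ℝ =>
      φ.normed volume Q * (ψ.normed volume R * g (P - Q - R))) (volume.prod volume) := by
    have h1 := (φ.integrable_normed (μ := volume)).mul_prod (ψ.integrable_normed (μ := volume))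
    have h2 : Measurable fun z : (ℝ × ℝ) × (ℝ × ℝ) => g (P - z.1 - z.2) := hm.comp (by fun_prop)
    refine (h1.mul_bdd (c := L) h2.aestronglyMeasurable (ae_of_all _ fun P => hL _)).congr
      (ae_of_all _ fun z => ?_)
    simp only [Function.uncurry]
    ring
  simp only [mollify]
  simp_rw [← integral_const_mul]
  rw [integral_integral_swap h]
  congr 1
  funext R
  congr 1
  funext Q
  rw [sub_right_comm]
  ring

theorem abs_mollify_sub_le (φ : ContDiffBump (0 : ℝ × ℝ)) {g : ℝ × ℝ → ℝ} {K : ℝ≥0}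
    (hg : LipschitzWith K g) (P : ℝ × ℝ) : |mollify φ g P - g P| ≤ K * φ.rOut := by
  have := φ.dist_normed_convolution_le (μ := volume) (x₀ := P) (ε := K * φ.rOut)
    hg.continuous.aestronglyMeasurable (fun x hx => (hg.dist_le_mul x P).trans
      (mul_le_mul_of_nonneg_left (Metric.mem_ball.1 hx).le K.2))
  rwa [Real.dist_eq] at this

/-- Jensen's inequality for the mollification. -/
theorem sq_mollify_le (φ : ContDiffBump (0 : ℝ × ℝ)) {g h : ℝ × ℝ → ℝ} (hm : Measurable g)
    {L : ℝ} (hL : ∀ P, |g P| ≤ L) (hm' : Measurable h) {L' : ℝ} (hL' : ∀ P, |h P| ≤ L')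
    {P : ℝ × ℝ} (hgh : ∀ Q, dist Q P < φ.rOut → g Q ^ 2 ≤ h Q) :
    mollify φ g P ^ 2 ≤ mollify φ h P := by
  -- `2 k g - k² ≤ g²` for every constant `k`; the value `k = mollify φ g P` is optimal.
  set k := mollify φ g P with hk
  have hi1 := integrable_normed_mul φ (g := fun Q => g (P - Q)) (by fun_prop) (fun Q => hL _)
  have hi2 := integrable_normed_mul φ (g := fun Q => h (P - Q)) (by fun_prop) (fun Q => hL' _)
  have h1 : ∫ Q, (2 * k * (φ.normed volume Q * g (P - Q)) - k ^ 2 * φ.normed volume Q)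
      ≤ mollify φ h P := by
    refine integral_mono ((hi1.const_mul _).sub (φ.integrable_normed.const_mul _)) hi2 fun Q => ?_
    by_cases hQ : Q ∈ Metric.ball (0 : ℝ × ℝ) φ.rOut
    · have h2 := hgh (P - Q) (by simpa [dist_eq_norm] using hQ)
      have h3 := φ.nonneg_normed (μ := volume) Q
      simp only
      nlinarith [mul_le_mul_of_nonneg_left h2 h3, mul_nonneg h3 (sq_nonneg (g (P - Q) - k))]
    · rw [← φ.support_normed_eq (μ := volume), Function.notMem_support] at hQ
      simp [hQ]
  rw [integral_sub (hi1.const_mul _) (φ.integrable_normed.const_mul _), integral_const_mul,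
    integral_const_mul, φ.integral_normed] at h1
  change 2 * k * k - _ ≤ _ at h1
  linarith

theorem LipschitzWith.mollify (φ : ContDiffBump (0 : ℝ × ℝ)) {g : ℝ × ℝ → ℝ} {K : ℝ≥0}
    (hg : LipschitzWith K g) : LipschitzWith K (mollify φ g) := by
  refine LipschitzWith.of_dist_le_mul fun P R => ?_
  have hi : ∀ P, Integrable fun Q => φ.normed volume Q * g (P - Q) := fun P =>
    (φ.continuous_normed.mul (hg.continuous.comp (by fun_prop))).integrable_of_hasCompactSupport
      φ.hasCompactSupport_normed.mul_right
  rw [Real.dist_eq, _root_.mollify, _root_.mollify, ← integral_sub (hi P) (hi R)]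
  have h1 : ‖∫ Q, (φ.normed volume Q * g (P - Q) - φ.normed volume Q * g (R - Q))‖
      ≤ ∫ Q, φ.normed volume Q * (K * dist P R) := by
    refine norm_integral_le_of_norm_le (φ.integrable_normed.mul_const _) (ae_of_all _ fun Q => ?_)
    rw [← mul_sub, norm_mul, Real.norm_of_nonneg (φ.nonneg_normed Q)]
    refine mul_le_mul_of_nonneg_left ?_ (φ.nonneg_normed Q)
    have := hg.dist_le_mul (P - Q) (R - Q)
    rwa [dist_sub_right, dist_eq_norm] at this
  rwa [integral_mul_const, φ.integral_normed, one_mul] at h1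

/-- Mollification commutes with directional derivatives. -/
theorem hasLineDerivAt_mollify (φ : ContDiffBump (0 : ℝ × ℝ)) {V a : ℝ × ℝ → ℝ} {v : ℝ × ℝ}
    (hV : Continuous V) (ha : Measurable a) {L : ℝ} (hL : ∀ P, |a P| ≤ L)
    (h : ∀ P, HasLineDerivAt ℝ V (a P) P v) (P : ℝ × ℝ) :
    HasLineDerivAt ℝ (mollify φ V) (mollify φ a P) P v := by
  unfold HasLineDerivAt _root_.mollify
  have hs : ∀ Q (s : ℝ), HasDerivAt (fun s : ℝ => V (P + s • v - Q)) (a (P + s • v - Q)) s := by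
    intro Q s
    have h1 := h (P + s • v - Q)
    unfold HasLineDerivAt at h1
    have h2 : HasDerivAt (fun r : ℝ => r - s) 1 s := (hasDerivAt_id s).sub_const s
    rw [← sub_self s] at h1
    have h3 := HasDerivAt.comp (h := fun r : ℝ => r - s) s h1 h2
    rw [mul_one] at h3
    refine h3.congr_of_eventuallyEq (Eventually.of_forall fun r => ?_)
    simp only [Function.comp, sub_smul]
    congr 1
    abel
  have := (hasDerivAt_integral_of_dominated_loc_of_deriv_le (μ := volume) (s := univ)
    (bound := fun Q => φ.normed volume Q * L)
    (F := fun (s : ℝ) Q => φ.normed volume Q * V (P + s • v - Q))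
    (F' := fun (s : ℝ) Q => φ.normed volume Q * a (P + s • v - Q)) (x₀ := (0 : ℝ))
    univ_mem ?_ ?_ ?_ ?_ ?_ ?_).2
  · simpa using this
  · exact Eventually.of_forall fun s => (φ.continuous_normed.mul
      (hV.comp (by fun_prop))).aestronglyMeasurable
  · exact (φ.continuous_normed.mul (hV.comp (by fun_prop))).integrable_of_hasCompactSupport
      φ.hasCompactSupport_normed.mul_right
  · exact (φ.continuous_normed.measurable.mul (ha.comp (by fun_prop))).aestronglyMeasurable
  · refine ae_of_all _ fun Q s _ => ?_
    rw [norm_mul, Real.norm_of_nonneg (φ.nonneg_normed Q)]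
    exact mul_le_mul_of_nonneg_left (hL _) (φ.nonneg_normed Q)
  · exact φ.integrable_normed.mul_const L
  · exact ae_of_all _ fun Q s _ => (hs Q s).const_mul _

/-- Bump functions concentrating at the origin of the plane. -/
noncomputable def shrinkingBump (n : ℕ) : ContDiffBump (0 : ℝ × ℝ) where
  rIn := 1 / (2 * ((n : ℝ) + 1))
  rOut := 1 / ((n : ℝ) + 1)
  rIn_pos := by positivity
  rIn_lt_rOut := by
    apply one_div_lt_one_div_of_lt <;> linarith [n.cast_nonneg (α := ℝ)]

theorem tendsto_rOut_shrinkingBump : Tendsto (fun n => (shrinkingBump n).rOut) atTop (𝓝 0) :=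
  tendsto_one_div_add_atTop_nhds_zero_nat

theorem ae_tendsto_mollify {g : ℝ × ℝ → ℝ} (hg : LocallyIntegrable g) :
    ∀ᵐ P, Tendsto (fun n => mollify (shrinkingBump n) g P) atTop (𝓝 (g P)) := by
  refine ContDiffBump.ae_convolution_tendsto_right_of_locallyIntegrable (K := 2)
    tendsto_rOut_shrinkingBump (Eventually.of_forall fun n => le_of_eq ?_) hg
  simp only [shrinkingBump]
  field_simp

theorem tendsto_mollify_of_continuous {g : ℝ × ℝ → ℝ} (hg : Continuous g) (P : ℝ × ℝ) :
    Tendsto (fun n => mollify (shrinkingBump n) g P) atTop (𝓝 (g P)) :=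
  ContDiffBump.convolution_tendsto_right_of_continuous tendsto_rOut_shrinkingBump hg P

/-! ### Potentials of distributionally closed 1-forms -/

/-- The 1-form `a dx + b dt` on the plane is closed in the sense of distributions. -/
def WeaklyClosed (a b : ℝ × ℝ → ℝ) : Prop :=
  ∀ φ : ℝ × ℝ → ℝ, ContDiff ℝ ∞ φ → HasCompactSupport φ →
    ∫ P, a P * fderiv ℝ φ P (0, 1) = ∫ P, b P * fderiv ℝ φ P (1, 0)

theorem WeaklyClosed.fderiv_mollify_eq {a b : ℝ × ℝ → ℝ} (h : WeaklyClosed a b)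
    (ha : LocallyIntegrable a) (hb : LocallyIntegrable b) (φ : ContDiffBump (0 : ℝ × ℝ))
    (P : ℝ × ℝ) : fderiv ℝ (mollify φ a) P (0, 1) = fderiv ℝ (mollify φ b) P (1, 0) := by
  have hs : ContDiff ℝ ∞ fun Q : ℝ × ℝ => φ.normed volume (P - Q) :=
    φ.contDiff_normed.comp (contDiff_const.sub contDiff_id)
  have hc : HasCompactSupport fun Q : ℝ × ℝ => φ.normed volume (P - Q) :=
    (φ.hasCompactSupport_normed (μ := volume)).comp_homeomorph (Homeomorph.subLeft P)
  have hd : ∀ Q v, fderiv ℝ (fun Q : ℝ × ℝ => φ.normed volume (P - Q)) Q v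
      = -fderiv ℝ (φ.normed volume) (P - Q) v := by
    intro Q v
    have h1 : HasFDerivAt (fun Q : ℝ × ℝ => P - Q) (-ContinuousLinearMap.id ℝ (ℝ × ℝ)) Q :=
      (hasFDerivAt_id Q).const_sub P
    have h2 : HasFDerivAt (φ.normed volume) (fderiv ℝ (φ.normed volume) (P - Q)) (P - Q) :=
      ((φ.contDiff_normed (n := 1)).differentiable one_ne_zero _).hasFDerivAt
    have h3 : HasFDerivAt (fun Q : ℝ × ℝ => φ.normed volume (P - Q)) _ Q := h2.comp Q h1
    rw [h3.fderiv]
    simp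
  have h1 := h _ hs hc
  simp only [hd, mul_neg, integral_neg, neg_inj] at h1
  rw [fderiv_mollify_apply φ ha, fderiv_mollify_apply φ hb]
  simpa only [mul_comm] using h1

theorem sub_eq_sub_of_hasLineDerivAt {V W a b : ℝ × ℝ → ℝ}
    (hVx : ∀ P, HasLineDerivAt ℝ V (a P) P (1, 0)) (hVt : ∀ P, HasLineDerivAt ℝ V (b P) P (0, 1))
    (hWx : ∀ P, HasLineDerivAt ℝ W (a P) P (1, 0)) (hWt : ∀ P, HasLineDerivAt ℝ W (b P) P (0, 1))
    (P Q : ℝ × ℝ) : V P - W P = V Q - W Q := by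
  have key : ∀ (v : ℝ × ℝ) (c : ℝ × ℝ → ℝ), (∀ P, HasLineDerivAt ℝ V (c P) P v) →
      (∀ P, HasLineDerivAt ℝ W (c P) P v) → ∀ P (s : ℝ), V (P + s • v) - W (P + s • v)
        = V P - W P := by
    intro v c hV hW P s
    have h0 : ∀ F : ℝ × ℝ → ℝ, (∀ P, HasLineDerivAt ℝ F (c P) P v) → ∀ r : ℝ,
        HasDerivAt (fun r : ℝ => F (P + r • v)) (c (P + r • v)) r := by
      intro F hF r
      have h1 := hF (P + r • v)
      unfold HasLineDerivAt at h1
      rw [← sub_self r] at h1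
      have h3 := HasDerivAt.comp (h := fun q : ℝ => q - r) r h1 ((hasDerivAt_id r).sub_const r)
      rw [mul_one] at h3
      refine h3.congr_of_eventuallyEq (Eventually.of_forall fun q => ?_)
      simp only [Function.comp, sub_smul]
      congr 1
      abel
    have h2 : ∀ r : ℝ, HasDerivAt (fun r : ℝ => V (P + r • v) - W (P + r • v)) 0 r := fun r => by
      have h4 := (h0 V hV r).sub (h0 W hW r)
      rw [sub_self] at h4
      exact h4
    have := is_const_of_deriv_eq_zero (fun r => (h2 r).differentiableAt) (fun r => (h2 r).deriv) s 0
    simpa using this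
  have h1 := key (1, 0) a hVx hWx Q (P.1 - Q.1)
  have h2 := key (0, 1) b hVt hWt (Q + (P.1 - Q.1) • (1, 0)) (P.2 - Q.2)
  have h3 : Q + (P.1 - Q.1) • ((1, 0) : ℝ × ℝ) + (P.2 - Q.2) • ((0, 1) : ℝ × ℝ) = P := by
    ext <;> simp
  rw [h3] at h2
  rw [h2, h1]

theorem norm_smul_fst_add_smul_snd_le {p q L : ℝ} (hp : |p| ≤ L) (hq : |q| ≤ L) :
    ‖p • ContinuousLinearMap.fst ℝ ℝ ℝ + q • ContinuousLinearMap.snd ℝ ℝ ℝ‖ ≤ 2 * L := by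
  have hL : 0 ≤ L := (abs_nonneg p).trans hp
  refine ContinuousLinearMap.opNorm_le_bound _ (by positivity) fun v => ?_
  simp only [add_apply, smul_apply,
    ContinuousLinearMap.coe_fst', ContinuousLinearMap.coe_snd', smul_eq_mul]
  calc ‖p * v.1 + q * v.2‖ ≤ |p| * ‖v.1‖ + |q| * ‖v.2‖ := by
        refine (norm_add_le _ _).trans (le_of_eq ?_)
        rw [norm_mul, norm_mul, Real.norm_eq_abs p, Real.norm_eq_abs q]
    _ ≤ L * ‖v‖ + L * ‖v‖ := by
        gcongr
        · exact norm_fst_le v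
        · exact norm_snd_le v
    _ = 2 * L * ‖v‖ := by ring

/-- The mollification of a bounded closed 1-form has a potential; it is Lipschitz. -/
theorem WeaklyClosed.exists_potential_mollify {a b : ℝ × ℝ → ℝ} (h : WeaklyClosed a b)
    (ha : Measurable a) (hb : Measurable b) {L : ℝ} (haL : ∀ P, |a P| ≤ L) (hbL : ∀ P, |b P| ≤ L)
    (φ : ContDiffBump (0 : ℝ × ℝ)) :
    ∃ V : ℝ × ℝ → ℝ, V 0 = 0 ∧ LipschitzWith (2 * L).toNNReal V ∧
      (∀ P, HasLineDerivAt ℝ V (mollify φ a P) P (1, 0)) ∧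
      ∀ P, HasLineDerivAt ℝ V (mollify φ b P) P (0, 1) := by
  have hai := locallyIntegrable_of_abs_le (μ := volume) ha haL
  have hbi := locallyIntegrable_of_abs_le (μ := volume) hb hbL
  have hA : Differentiable ℝ (mollify φ a) := (contDiff_mollify φ hai).differentiable (by simp)
  have hB : Differentiable ℝ (mollify φ b) := (contDiff_mollify φ hbi).differentiable (by simp)
  let form : ℝ × ℝ → ℝ × ℝ →L[ℝ] ℝ := fun P =>
    mollify φ a P • ContinuousLinearMap.fst ℝ ℝ ℝ + mollify φ b P • ContinuousLinearMap.snd ℝ ℝ ℝ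
  have hform : ∀ P v w, fderiv ℝ form P v w
      = fderiv ℝ (mollify φ a) P v * w.1 + fderiv ℝ (mollify φ b) P v * w.2 := by
    intro P v w
    have h1 : HasFDerivAt form _ P := ((hA P).hasFDerivAt.smul_const
      (ContinuousLinearMap.fst ℝ ℝ ℝ)).add ((hB P).hasFDerivAt.smul_const
        (ContinuousLinearMap.snd ℝ ℝ ℝ))
    rw [h1.fderiv]
    simp
  have hlin : ∀ (l : ℝ × ℝ →L[ℝ] ℝ) (v : ℝ × ℝ), l v = v.1 * l (1, 0) + v.2 * l (0, 1) := by
    intro l v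
    conv_lhs => rw [show v = v.1 • ((1, 0) : ℝ × ℝ) + v.2 • ((0, 1) : ℝ × ℝ) by ext <;> simp]
    rw [map_add, map_smul, map_smul, smul_eq_mul, smul_eq_mul]
  have hd : DifferentiableOn ℝ form univ := fun P _ =>
    (((hA P).smul_const (ContinuousLinearMap.fst ℝ ℝ ℝ)).add
      ((hB P).smul_const (ContinuousLinearMap.snd ℝ ℝ ℝ))).differentiableWithinAt
  obtain ⟨f, hf⟩ := convex_univ.exists_forall_hasFDerivAt_of_fderiv_symmetric isOpen_univ hd
    (by
      intro P _ v w
      rw [hform, hform, hlin (fderiv ℝ (mollify φ a) P) v, hlin (fderiv ℝ (mollify φ a) P) w,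
        hlin (fderiv ℝ (mollify φ b) P) v, hlin (fderiv ℝ (mollify φ b) P) w,
        h.fderiv_mollify_eq hai hbi φ P]
      ring)
  have hV : ∀ P, HasFDerivAt (fun P => f P - f 0) (form P) P := fun P =>
    (hf P (mem_univ P)).sub_const _
  refine ⟨fun P => f P - f 0, sub_self _, ?_, fun P => ?_, fun P => ?_⟩
  · refine lipschitzWith_of_nnnorm_fderiv_le (𝕜 := ℝ) (fun P => (hV P).differentiableAt) fun P => ?_
    rw [(hV P).fderiv, ← NNReal.coe_le_coe, coe_nnnorm]
    exact (norm_smul_fst_add_smul_snd_le (abs_mollify_le φ haL P)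
      (abs_mollify_le φ hbL P)).trans (Real.le_coe_toNNReal _)
  · simpa [form] using (hV P).hasLineDerivAt (1, 0)
  · simpa [form] using (hV P).hasLineDerivAt (0, 1)

/-- A bounded 1-form `a dx + b dt` that is closed in the sense of distributions has a Lipschitz
potential `U`. That `U` is a potential is expressed through mollifications. -/
theorem WeaklyClosed.exists_potential {a b : ℝ × ℝ → ℝ} (h : WeaklyClosed a b)
    (ha : Measurable a) (hb : Measurable b) {L : ℝ} (haL : ∀ P, |a P| ≤ L)
    (hbL : ∀ P, |b P| ≤ L) :
    ∃ (K : ℝ≥0) (U : ℝ × ℝ → ℝ), LipschitzWith K U ∧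
      (∀ φ P, HasLineDerivAt ℝ (mollify φ U) (mollify φ a P) P (1, 0)) ∧
      ∀ φ P, HasLineDerivAt ℝ (mollify φ U) (mollify φ b P) P (0, 1) := by
  choose V hV0 hVL hVx hVt using fun φ => h.exists_potential_mollify ha hb haL hbL φ
  set K : ℝ≥0 := (2 * L).toNNReal
  have hmeas : ∀ (φ : ContDiffBump (0 : ℝ × ℝ)) {g : ℝ × ℝ → ℝ}, Measurable g →
      (∀ P, |g P| ≤ L) → Measurable (mollify φ g) := fun φ g hg hgL =>
    (contDiff_mollify φ (locallyIntegrable_of_abs_le hg hgL)).continuous.measurable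
  -- `mollify φ (V ψ)` and `mollify ψ (V φ)` have the same gradient.
  have hcomm : ∀ φ ψ P, mollify φ (V ψ) P - mollify ψ (V φ) P
      = mollify φ (V ψ) 0 - mollify ψ (V φ) 0 := by
    intro φ ψ P
    have hx := fun P => hasLineDerivAt_mollify φ (hVL ψ).continuous (hmeas ψ ha haL)
      (abs_mollify_le ψ haL) (hVx ψ) P
    have ht := fun P => hasLineDerivAt_mollify φ (hVL ψ).continuous (hmeas ψ hb hbL)
      (abs_mollify_le ψ hbL) (hVt ψ) P
    have hx' := fun P => hasLineDerivAt_mollify ψ (hVL φ).continuous (hmeas φ ha haL)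
      (abs_mollify_le φ haL) (hVx φ) P
    have ht' := fun P => hasLineDerivAt_mollify ψ (hVL φ).continuous (hmeas φ hb hbL)
      (abs_mollify_le φ hbL) (hVt φ) P
    rw [mollify_comm ψ φ ha haL] at hx'
    rw [mollify_comm ψ φ hb hbL] at ht'
    exact sub_eq_sub_of_hasLineDerivAt hx ht hx' ht' P 0
  -- so the potentials of the mollified forms are uniformly Cauchy.
  have hdist : ∀ φ ψ P, |V φ P - V ψ P| ≤ 2 * K * (φ.rOut + ψ.rOut) := by
    intro φ ψ P
    have h1 := hcomm φ ψ P
    have h2 := abs_le.1 (abs_mollify_sub_le φ (hVL ψ) P)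
    have h3 := abs_le.1 (abs_mollify_sub_le ψ (hVL φ) P)
    have h4 := abs_le.1 (abs_mollify_sub_le φ (hVL ψ) 0)
    have h5 := abs_le.1 (abs_mollify_sub_le ψ (hVL φ) 0)
    rw [hV0] at h4 h5
    rw [abs_le]
    constructor <;> linarith [h2.1, h2.2, h3.1, h3.2, h4.1, h4.2, h5.1, h5.2]
  have hanti : ∀ N n : ℕ, N ≤ n → (shrinkingBump n).rOut ≤ (shrinkingBump N).rOut := by
    intro N n hNn
    simp only [shrinkingBump]
    gcongr
  have hcauchy : ∀ P, CauchySeq fun n => V (shrinkingBump n) P := by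
    intro P
    refine cauchySeq_of_le_tendsto_0 (fun N => 2 * K * ((shrinkingBump N).rOut
      + (shrinkingBump N).rOut)) (fun n m N hn hm => ?_) ?_
    · refine (hdist _ _ P).trans ?_
      gcongr
      · exact hanti N n hn
      · exact hanti N m hm
    · simpa using (tendsto_rOut_shrinkingBump.add tendsto_rOut_shrinkingBump).const_mul
        (2 * (K : ℝ))
  choose U hU using fun P => cauchySeq_tendsto_of_complete (hcauchy P)
  have hUL : LipschitzWith K U := LipschitzWith.of_dist_le_mul fun P Q =>
    le_of_tendsto ((hU P).dist (hU Q)) (Eventually.of_forall fun n => (hVL _).dist_le_mul P Q)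
  have hlim : ∀ φ P, Tendsto (fun n => mollify φ (V (shrinkingBump n)) P) atTop
      (𝓝 (mollify φ U P)) := by
    intro φ P
    refine tendsto_integral_of_dominated_convergence
      (fun Q => φ.normed volume Q * (K * ‖P - Q‖)) (fun n => ?_) ?_ (fun n => ?_) ?_
    · exact (φ.continuous_normed.mul ((hVL _).continuous.comp (by fun_prop))).aestronglyMeasurable
    · exact (φ.continuous_normed.mul (by fun_prop)).integrable_of_hasCompactSupport
        φ.hasCompactSupport_normed.mul_right
    · refine ae_of_all _ fun Q => ?_
      rw [norm_mul, Real.norm_of_nonneg (φ.nonneg_normed Q)]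
      refine mul_le_mul_of_nonneg_left ?_ (φ.nonneg_normed Q)
      have := (hVL (shrinkingBump n)).dist_le_mul (P - Q) 0
      rwa [hV0, dist_zero_right, dist_zero_right] at this
    · exact ae_of_all _ fun Q => (hU _).const_mul _
  have hpot : ∀ φ P, mollify φ U P = V φ P + mollify φ U 0 := by
    intro φ P
    have h1 := (hlim φ P).sub (tendsto_mollify_of_continuous (hVL φ).continuous P)
    have h2 := (hlim φ 0).sub (tendsto_mollify_of_continuous (hVL φ).continuous 0)
    have h3 := tendsto_nhds_unique (h1.congr fun n => hcomm φ (shrinkingBump n) P) h2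
    rw [hV0] at h3
    linarith
  refine ⟨K, U, hUL, fun φ P => ?_, fun φ P => ?_⟩
  · rw [funext (hpot φ)]
    exact HasDerivAt.add_const _ (hVx φ P)
  · rw [funext (hpot φ)]
    exact HasDerivAt.add_const _ (hVt φ P)

/-! ### Extension of entropy solutions to the plane -/

theorem ae_ae_of_ae_univ_prod {S : Set ℝ} {p : ℝ × ℝ → Prop}
    (h : ∀ᵐ P ∂(volume.restrict (univ ×ˢ S)), p P) :
    ∀ᵐ t ∂(volume.restrict S), ∀ᵐ x, p (x, t) := by
  rw [Measure.volume_eq_prod, ← Measure.prod_restrict, Measure.restrict_univ] at h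
  exact Measure.ae_ae_of_ae_prod ((Measure.measurePreserving_swap
    (μ := volume.restrict S) (ν := volume)).quasiMeasurePreserving.ae h)

theorem setIntegral_univ_prod {S : Set ℝ} {F : ℝ × ℝ → ℝ} (h : IntegrableOn F (univ ×ˢ S)) :
    ∫ P in univ ×ˢ S, F P = ∫ t in S, ∫ x, F (x, t) := by
  rw [IntegrableOn, Measure.volume_eq_prod, ← Measure.prod_restrict, Measure.restrict_univ] at h
  rw [Measure.volume_eq_prod, ← Measure.prod_restrict, Measure.restrict_univ, integral_prod_symm _ h]

/-- A representative of an `L^∞` function that is bounded by the `L^∞` norm everywhere. -/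
theorem MeasureTheory.MemLp.exists_bounded_representative {α : Type*} [MeasurableSpace α]
    {μ : Measure α} {f : α → ℝ} (hf : MemLp f ∞ μ) :
    ∃ g : α → ℝ, Measurable g ∧ (∀ x, |g x| ≤ (eLpNorm f ∞ μ).toReal) ∧ f =ᵐ[μ] g := by
  set M := (eLpNorm f ∞ μ).toReal with hM
  have hM0 : 0 ≤ M := ENNReal.toReal_nonneg
  have hm := hf.aestronglyMeasurable
  refine ⟨fun x => max (-M) (min M (hm.mk f x)), ?_, fun x => ?_, ?_⟩
  · exact measurable_const.max (measurable_const.min hm.stronglyMeasurable_mk.measurable)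
  · rw [abs_le]
    exact ⟨le_max_left _ _, max_le (by linarith) (min_le_left _ _)⟩
  · filter_upwards [hm.ae_eq_mk, ae_le_eLpNormEssSup (f := f) (μ := μ)] with x h1 h2
    rw [← eLpNorm_exponent_top] at h2
    have h3 : |f x| ≤ M := by
      have := ENNReal.toReal_mono hf.eLpNorm_ne_top h2
      simpa [hM] using this
    rw [← h1, min_eq_right (abs_le.1 h3).2, max_eq_right (abs_le.1 h3).1]

theorem exists_abs_comp_le {η : ℝ → ℝ} (hη : Continuous η) (L : ℝ) :
    ∃ C, ∀ r, |r| ≤ L → |η r| ≤ C := by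
  obtain ⟨C, hC⟩ := (isCompact_Icc (a := -L) (b := L)).exists_bound_of_continuousOn hη.continuousOn
  exact ⟨C, fun r hr => hC r (abs_le.1 hr)⟩

theorem integrable_comp_mul {v : ℝ × ℝ → ℝ} (hv : Measurable v) {L : ℝ} (hL : ∀ P, |v P| ≤ L)
    {η : ℝ → ℝ} (hη : Continuous η) {g : ℝ × ℝ → ℝ} (hg : Continuous g)
    (hgc : HasCompactSupport g) : Integrable fun P => η (v P) * g P := by
  obtain ⟨C, hC⟩ := exists_abs_comp_le hη L
  exact (hg.integrable_of_hasCompactSupport hgc).bdd_mul (c := C)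
    (hη.measurable.comp hv).aestronglyMeasurable (ae_of_all _ fun P => hC _ (hL P))

theorem hasDerivAt_slice_snd {Φ : ℝ × ℝ → ℝ} (hΦ : Differentiable ℝ Φ) (x t : ℝ) :
    HasDerivAt (fun r => Φ (x, r)) (fderiv ℝ Φ (x, t) (0, 1)) t :=
  (hΦ (x, t)).hasFDerivAt.comp_hasDerivAt t ((hasDerivAt_const t x).prodMk (hasDerivAt_id t))

theorem hasDerivAt_slice_fst {Φ : ℝ × ℝ → ℝ} (hΦ : Differentiable ℝ Φ) (x t : ℝ) :
    HasDerivAt (fun y => Φ (y, t)) (fderiv ℝ Φ (x, t) (1, 0)) x :=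
  (hΦ (x, t)).hasFDerivAt.comp_hasDerivAt x ((hasDerivAt_id x).prodMk (hasDerivAt_const x t))

/-- The time component `-f(v) 1_{t > 0}` of the 1-form whose potential is studied. -/
noncomputable def timeComponent (v : ℝ × ℝ → ℝ) (P : ℝ × ℝ) : ℝ :=
  if 0 < P.2 then -(v P ^ 2 / 2) else 0

/-- An entropy solution of Burgers' equation, bounded by `L`, and extended to `t ≤ 0` by its initial
data, which are bounded by `M`. The weak formulation says that `v dx - f(v) 1_{t > 0} dt` is
closed on the whole plane; the initial condition is part of this. -/
structure IsPlaneSolution (M L : ℝ) (v : ℝ × ℝ → ℝ) : Prop where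
  measurable : Measurable v
  abs_le : ∀ P, |v P| ≤ L
  abs_le_initial : ∀ P : ℝ × ℝ, P.2 ≤ 0 → |v P| ≤ M
  closed : WeaklyClosed v (timeComponent v)
  entropy : ∀ η q : ℝ → ℝ, IsEntropyPair burgersFlux η q → Continuous η → Continuous q →
    ∀ φ : ℝ × ℝ → ℝ, ContDiff ℝ ∞ φ → HasCompactSupport φ → (∀ P, 0 ≤ φ P) →
      (∀ x, φ (x, 0) = 0) → 0 ≤ ∫ P in univ ×ˢ Ioi (0 : ℝ),
        (η (v P) * fderiv ℝ φ P (0, 1) + q (v P) * fderiv ℝ φ P (1, 0))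

theorem balance_eq {u₀ : ℝ → ℝ} {u : ℝ → ℝ → ℝ} {v : ℝ × ℝ → ℝ} (hv : Measurable v) {L : ℝ}
    (hL : ∀ P, |v P| ≤ L) (huv : ∀ᵐ t ∂(volume.restrict (Ioi (0 : ℝ))), ∀ᵐ x, u x t = v (x, t))
    {η q : ℝ → ℝ} (hη : Continuous η) (hq : Continuous q) {φ : ℝ × ℝ → ℝ} (hφ : ContDiff ℝ ∞ φ)
    (hφc : HasCompactSupport φ) :
    balance η q u₀ u (fun x t => φ (x, t)) =
      (∫ P in univ ×ˢ Ioi (0 : ℝ),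
        (η (v P) * fderiv ℝ φ P (0, 1) + q (v P) * fderiv ℝ φ P (1, 0)))
        + ∫ x, η (u₀ x) * φ (x, 0) := by
  have hd : Differentiable ℝ φ := hφ.differentiable (by simp)
  have hc : ∀ w, Continuous fun P => fderiv ℝ φ P w := fun w =>
    (hφ.continuous_fderiv (by simp)).clm_apply continuous_const
  have hi : Integrable fun P =>
      (η (v P) * fderiv ℝ φ P (0, 1) + q (v P) * fderiv ℝ φ P (1, 0)) :=
    (integrable_comp_mul hv hL hη (hc _) (hφc.fderiv_apply ℝ _)).add
      (integrable_comp_mul hv hL hq (hc _) (hφc.fderiv_apply ℝ _))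
  rw [balance, setIntegral_univ_prod hi.integrableOn]
  congr 1
  refine integral_congr_ae ?_
  filter_upwards [huv] with t ht
  refine integral_congr_ae ?_
  filter_upwards [ht] with x hx
  rw [hx, (hasDerivAt_slice_snd hd x t).deriv, (hasDerivAt_slice_fst hd x t).deriv]

theorem hasCompactSupport_slice {φ : ℝ × ℝ → ℝ} (h : HasCompactSupport φ) (x : ℝ) :
    HasCompactSupport fun t => φ (x, t) :=
  h.comp_isClosedEmbedding (g := fun t : ℝ => (x, t))
    (Topology.IsClosedEmbedding.of_continuous_injective_isClosedMap (by fun_prop)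
      (fun _ _ h => (Prod.ext_iff.1 h).2) (isClosedMap_prodMk_left x))

/-- Extending `u` by the initial datum to `t ≤ 0` turns the weak formulation, initial condition
included, into closedness of a 1-form on the whole plane. -/
theorem IsEntropySolution.exists_isPlaneSolution {u₀ : ℝ → ℝ} (hu₀ : MemLp u₀ ∞ volume)
    {u : ℝ → ℝ → ℝ} (hu : IsEntropySolution burgersFlux u₀ u) :
    ∃ L v, IsPlaneSolution (eLpNorm u₀ ∞ volume).toReal L v ∧
      ∀ᵐ t ∂(volume.restrict (Ioi (0 : ℝ))), ∀ᵐ x, u x t = v (x, t) := by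
  obtain ⟨w, hwm, hwL, hw⟩ := hu.memLp_top.exists_bounded_representative
  obtain ⟨w₀, hwm₀, hwL₀, hw₀⟩ := hu₀.exists_bounded_representative
  set M := (eLpNorm u₀ ∞ volume).toReal
  set L := (eLpNorm (fun p : ℝ × ℝ => u p.1 p.2) ∞ (volume.restrict (univ ×ˢ Ioi (0 : ℝ)))).toReal
  let v : ℝ × ℝ → ℝ := fun P => if 0 < P.2 then w P else w₀ P.1
  have hpos : MeasurableSet {P : ℝ × ℝ | 0 < P.2} := measurableSet_lt measurable_const measurable_snd
  have hvm : Measurable v := Measurable.ite hpos hwm (hwm₀.comp measurable_fst)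
  have hvL : ∀ P, |v P| ≤ max L M := fun P => by
    by_cases h : 0 < P.2
    · simp only [v, h, if_true]
      exact (hwL P).trans (le_max_left _ _)
    · simp only [v, h, if_false]
      exact (hwL₀ P.1).trans (le_max_right _ _)
  have huv : ∀ᵐ t ∂(volume.restrict (Ioi (0 : ℝ))), ∀ᵐ x, u x t = v (x, t) := by
    filter_upwards [ae_ae_of_ae_univ_prod hw, ae_restrict_mem measurableSet_Ioi] with t ht h0
    filter_upwards [ht] with x hx
    simp only [v, mem_Ioi.1 h0, if_true]
    exact hx
  have hc : ∀ {φ : ℝ × ℝ → ℝ}, ContDiff ℝ ∞ φ → ∀ w, Continuous fun P => fderiv ℝ φ P w :=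
    fun hφ w => (hφ.continuous_fderiv (by simp)).clm_apply continuous_const
  have hflux : Continuous burgersFlux := by unfold burgersFlux; fun_prop
  refine ⟨max L M, v, ⟨hvm, hvL, fun P hP => ?_, ?_, ?_⟩, huv⟩
  · simp only [v, hP.not_gt, if_false]
    exact hwL₀ P.1
  · intro φ hφ hφc
    have h1 := hu.weak (fun x t => φ (x, t)) ⟨hφ, hφc⟩
    rw [balance_eq hvm hvL huv continuous_id hflux hφ hφc] at h1
    have hi1 := integrable_comp_mul hvm hvL continuous_id (hc hφ (0, 1)) (hφc.fderiv_apply ℝ _)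
    have hi2 := integrable_comp_mul hvm hvL hflux (hc hφ (1, 0)) (hφc.fderiv_apply ℝ _)
    rw [integral_add hi1.integrableOn hi2.integrableOn] at h1
    have hS : (univ ×ˢ Ioi (0 : ℝ) : Set (ℝ × ℝ)) = {P | 0 < P.2} := by ext; simp
    -- the initial term is the integral over `t ≤ 0`
    have h2 : ∫ P in (univ ×ˢ Ioi (0 : ℝ))ᶜ, v P * fderiv ℝ φ P (0, 1)
        = ∫ x, u₀ x * φ (x, 0) := by
      have hS' : (univ ×ˢ Ioi (0 : ℝ) : Set (ℝ × ℝ))ᶜ = univ ×ˢ Iic 0 := by ext; simp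
      have hi1' : IntegrableOn (fun P => v P * fderiv ℝ φ P (0, 1)) (univ ×ˢ Iic (0 : ℝ)) :=
        hi1.integrableOn
      rw [hS']
      rw [IntegrableOn, Measure.volume_eq_prod, ← Measure.prod_restrict,
        Measure.restrict_univ] at hi1'
      rw [Measure.volume_eq_prod, ← Measure.prod_restrict, Measure.restrict_univ,
        integral_prod _ hi1']
      refine integral_congr_ae ?_
      filter_upwards [hw₀] with x hx
      have h3 : ∀ t ∈ Iic (0 : ℝ), v (x, t) * fderiv ℝ φ (x, t) (0, 1)
          = u₀ x * deriv (fun t => φ (x, t)) t := by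
        intro t ht
        rw [(hasDerivAt_slice_snd (hφ.differentiable (by simp)) x t).deriv, hx]
        simp only [v, (mem_Iic.1 ht).not_gt, if_false]
      rw [setIntegral_congr_fun measurableSet_Iic h3, integral_const_mul,
        HasCompactSupport.integral_Iic_deriv_eq _ (hasCompactSupport_slice hφc x)]
      exact (hφ.of_le (by simp)).comp (contDiff_const.prodMk contDiff_id)
    have h4 : ∫ P, timeComponent v P * fderiv ℝ φ P (1, 0)
        = -∫ P in univ ×ˢ Ioi (0 : ℝ), burgersFlux (v P) * fderiv ℝ φ P (1, 0) := by
      rw [← integral_neg, ← integral_indicator (hS ▸ hpos)]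
      congr 1
      funext P
      by_cases hP : 0 < P.2
      · rw [indicator_of_mem (by simpa using hP)]
        simp only [timeComponent, hP, if_true, burgersFlux]
        ring
      · rw [indicator_of_notMem (by simpa using hP)]
        simp [timeComponent, hP]
    have h5 := integral_add_compl (hS ▸ hpos : MeasurableSet (univ ×ˢ Ioi (0 : ℝ))) hi1
    simp only [id] at h1 h5
    rw [h4, ← h5, h2]
    linarith
  · intro η q hηq hη hq φ hφ hφc hφ0 hφi
    have h1 := hu.entropy η q hηq (fun x t => φ (x, t)) ⟨hφ, hφc⟩ (fun x t _ => hφ0 _)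
    rw [balance_eq hvm hvL huv hη hq hφ hφc] at h1
    simpa [hφi] using h1

/-! ### Lipschitz potentials as test functions -/

/-- `U` is a Lipschitz potential of the 1-form `v dx - f(v) 1_{t > 0} dt`. The equations
`∂ₓU = v` and `∂ₜU = -f(v) 1_{t > 0}` hold in the sense of distributions; they are stated as
classical equations for all mollifications of `U`. -/
structure IsPotential (K : ℝ≥0) (v U : ℝ × ℝ → ℝ) : Prop where
  lipschitz : LipschitzWith K U
  hasLineDerivAt_fst : ∀ φ P, HasLineDerivAt ℝ (mollify φ U) (mollify φ v P) P (1, 0)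
  hasLineDerivAt_snd : ∀ φ P,
    HasLineDerivAt ℝ (mollify φ U) (mollify φ (timeComponent v) P) P (0, 1)

theorem measurable_timeComponent {v : ℝ × ℝ → ℝ} (hv : Measurable v) :
    Measurable (timeComponent v) := by
  unfold timeComponent
  exact Measurable.ite (measurableSet_lt measurable_const measurable_snd)
    ((hv.pow_const 2).div_const 2).neg measurable_const

theorem abs_timeComponent_le {v : ℝ × ℝ → ℝ} {L : ℝ} (hL : ∀ P, |v P| ≤ L) (P : ℝ × ℝ) :
    |timeComponent v P| ≤ L ^ 2 / 2 := by
  unfold timeComponent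
  have h := sq_le_sq' (abs_le.1 (hL P)).1 (abs_le.1 (hL P)).2
  split_ifs
  · rw [abs_neg, abs_of_nonneg (by positivity)]
    linarith
  · rw [abs_zero]
    positivity

theorem IsPlaneSolution.exists_isPotential {M L : ℝ} {v : ℝ × ℝ → ℝ} (hv : IsPlaneSolution M L v) :
    ∃ K U, IsPotential K v U := by
  obtain ⟨K, U, h1, h2, h3⟩ := hv.closed.exists_potential hv.measurable
    (measurable_timeComponent hv.measurable) (L := max L (L ^ 2 / 2))
    (fun P => (hv.abs_le P).trans (le_max_left _ _))
    (fun P => (abs_timeComponent_le hv.abs_le P).trans (le_max_right _ _))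
  exact ⟨K, U, h1, h2, h3⟩

theorem fderiv_mul_comp_apply {χ ψ β : ℝ × ℝ → ℝ} {γ : ℝ → ℝ} (hχ : Differentiable ℝ χ)
    (hψ : Differentiable ℝ ψ) (hβ : Differentiable ℝ β) (hγ : Differentiable ℝ γ)
    (P w : ℝ × ℝ) : fderiv ℝ (fun P => χ P * γ (ψ P - β P)) P w
      = fderiv ℝ χ P w * γ (ψ P - β P)
        + χ P * (deriv γ (ψ P - β P) * (fderiv ℝ ψ P w - fderiv ℝ β P w)) := by
  have h1 : HasFDerivAt (fun P => γ (ψ P - β P)) _ P :=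
    (hγ _).hasDerivAt.comp_hasFDerivAt P ((hψ P).hasFDerivAt.sub (hβ P).hasFDerivAt)
  have h2 : HasFDerivAt (fun P => χ P * γ (ψ P - β P)) _ P := (hχ P).hasFDerivAt.mul h1
  rw [h2.fderiv]
  simp only [add_apply, smul_apply, sub_apply, smul_eq_mul]
  ring

/-- Test functions of the form `χ γ(ψ - U)` with a merely Lipschitz function `U` are admissible:
passage to the limit in the mollification of `U`. -/
theorem tendsto_integral_fderiv_cutoff {v U g χ ψ : ℝ × ℝ → ℝ} {η γ : ℝ → ℝ} {K : ℝ≥0}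
    {L L' : ℝ} {w : ℝ × ℝ} (hv : Measurable v) (hvL : ∀ P, |v P| ≤ L) (hη : Continuous η)
    (hU : LipschitzWith K U) (hg : Measurable g) (hgL : ∀ P, |g P| ≤ L')
    (hUg : ∀ φ P, HasLineDerivAt ℝ (mollify φ U) (mollify φ g P) P w)
    (hχ : ContDiff ℝ ∞ χ) (hχc : HasCompactSupport χ) (hψ : ContDiff ℝ ∞ ψ) (hγ : ContDiff ℝ ∞ γ)
    (S : Set (ℝ × ℝ)) :
    Tendsto (fun n => ∫ P in S, η (v P) *
        fderiv ℝ (fun P => χ P * γ (ψ P - mollify (shrinkingBump n) U P)) P w) atTop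
      (𝓝 (∫ P in S, η (v P) * (fderiv ℝ χ P w * γ (ψ P - U P)
        + χ P * (deriv γ (ψ P - U P) * (fderiv ℝ ψ P w - g P))))) := by
  have hUi : LocallyIntegrable U := hU.continuous.locallyIntegrable
  have hmd : ∀ φ, ContDiff ℝ ∞ (mollify φ U) := fun φ => contDiff_mollify φ hUi
  have hdγ : Continuous (deriv γ) := hγ.continuous_deriv (by simp)
  have hcw : ∀ {f : ℝ × ℝ → ℝ}, ContDiff ℝ ∞ f → Continuous fun P => fderiv ℝ f P w :=
    fun hf => (hf.continuous_fderiv (by simp)).clm_apply continuous_const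
  have hfd : ∀ n P, fderiv ℝ (fun P => χ P * γ (ψ P - mollify (shrinkingBump n) U P)) P w
      = fderiv ℝ χ P w * γ (ψ P - mollify (shrinkingBump n) U P)
        + χ P * (deriv γ (ψ P - mollify (shrinkingBump n) U P)
          * (fderiv ℝ ψ P w - mollify (shrinkingBump n) g P)) := by
    intro n P
    have hd := (hmd (shrinkingBump n)).differentiable (by simp)
    rw [fderiv_mul_comp_apply (hχ.differentiable (by simp)) (hψ.differentiable (by simp)) hd
      (hγ.differentiable (by simp))]
    rw [((hd P).hasFDerivAt.hasLineDerivAt w).unique (hUg _ P)]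
  simp only [hfd]
  obtain ⟨C, hC⟩ := exists_abs_comp_le hη L
  -- bounds on the support of `χ`
  obtain ⟨C₁, hC₁⟩ := hχc.isCompact.exists_bound_of_continuousOn
    (f := fun P => ψ P - U P) (hψ.continuous.sub hU.continuous).continuousOn
  have hB : ∀ n, ∀ P ∈ tsupport χ, |ψ P - mollify (shrinkingBump n) U P| ≤ C₁ + K := by
    intro n P hP
    have h1 := abs_le.1 (hC₁ P hP)
    have h2 := abs_le.1 (abs_mollify_sub_le (shrinkingBump n) hU P)
    have h3 : (K : ℝ) * (shrinkingBump n).rOut ≤ K := by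
      refine mul_le_of_le_one_right K.2 ?_
      simp only [shrinkingBump]
      rw [div_le_one (by positivity)]
      linarith [n.cast_nonneg (α := ℝ)]
    rw [abs_le]
    constructor <;> linarith [h1.1, h1.2, h2.1, h2.2]
  obtain ⟨C₂, hC₂⟩ := exists_abs_comp_le hγ.continuous (C₁ + K)
  obtain ⟨C₃, hC₃⟩ := exists_abs_comp_le hdγ (C₁ + K)
  have hC0 : 0 ≤ C := (abs_nonneg _).trans (hC (v 0) (hvL 0))
  have hχw : ∀ P, P ∉ tsupport χ → fderiv ℝ χ P = 0 := fun P hP => by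
    have := mt (fun h => tsupport_fderiv_subset ℝ (f := χ) (subset_tsupport _ h)) hP
    simpa using this
  refine tendsto_integral_of_dominated_convergence
    (fun P => C * (|fderiv ℝ χ P w| * C₂ + |χ P| * (C₃ * (|fderiv ℝ ψ P w| + L'))))
    (fun n => ?_) ?_ (fun n => ?_) ?_
  · refine Measurable.aestronglyMeasurable ?_
    have h1 : Measurable (mollify (shrinkingBump n) g) :=
      (contDiff_mollify _ (locallyIntegrable_of_abs_le hg hgL)).continuous.measurable
    have h2 := (hmd (shrinkingBump n)).continuous.measurable
    have h3 := hψ.continuous.measurable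
    exact (hη.measurable.comp hv).mul (((hcw hχ).measurable.mul (hγ.continuous.measurable.comp
      (h3.sub h2))).add (hχ.continuous.measurable.mul ((hdγ.measurable.comp (h3.sub h2)).mul
        ((hcw hψ).measurable.sub h1))))
  · refine (Continuous.integrable_of_hasCompactSupport ?_ ?_).integrableOn
    · have h1 := hcw hχ
      have h2 := hcw hψ
      have h3 := hχ.continuous
      fun_prop
    · refine HasCompactSupport.intro hχc fun P hP => ?_
      rw [image_eq_zero_of_notMem_tsupport hP, hχw P hP]
      simp
  · refine ae_of_all _ fun P => ?_
    rw [norm_mul]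
    by_cases hP : P ∈ tsupport χ
    · have h1 : |γ (ψ P - mollify (shrinkingBump n) U P)| ≤ C₂ := hC₂ _ (hB n P hP)
      have h2 : |deriv γ (ψ P - mollify (shrinkingBump n) U P)| ≤ C₃ := hC₃ _ (hB n P hP)
      have h3 := abs_mollify_le (shrinkingBump n) hgL P
      refine mul_le_mul (hC _ (hvL P)) ?_ (norm_nonneg _) hC0
      refine (norm_add_le _ _).trans ?_
      rw [norm_mul, norm_mul, norm_mul]
      simp only [Real.norm_eq_abs]
      have h4 : |fderiv ℝ ψ P w - mollify (shrinkingBump n) g P| ≤ |fderiv ℝ ψ P w| + L' :=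
        (abs_sub _ _).trans (by linarith)
      have h5 : 0 ≤ C₃ := (abs_nonneg _).trans h2
      gcongr
    · rw [image_eq_zero_of_notMem_tsupport hP, hχw P hP]
      simp
  · refine ae_restrict_of_ae ?_
    filter_upwards [ae_tendsto_mollify (locallyIntegrable_of_abs_le hg hgL)] with P hP
    have h1 : Tendsto (fun n => ψ P - mollify (shrinkingBump n) U P) atTop (𝓝 (ψ P - U P)) :=
      tendsto_const_nhds.sub (tendsto_mollify_of_continuous hU.continuous P)
    have h2 := (hγ.continuous.tendsto _).comp h1
    have h3 := (hdγ.tendsto _).comp h1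
    exact ((h2.const_mul _).add ((h3.mul (hP.const_sub _)).const_mul _)).const_mul _

theorem integrable_fderiv_cutoff {v U g χ ψ : ℝ × ℝ → ℝ} {η γ : ℝ → ℝ} {L L' : ℝ}
    (hv : Measurable v) (hvL : ∀ P, |v P| ≤ L) (hη : Continuous η) (hU : Continuous U)
    (hg : Measurable g) (hgL : ∀ P, |g P| ≤ L') (hχ : ContDiff ℝ ∞ χ) (hχc : HasCompactSupport χ)
    (hψ : ContDiff ℝ ∞ ψ) (hγ : ContDiff ℝ ∞ γ) (w : ℝ × ℝ) :
    Integrable fun P => η (v P) * (fderiv ℝ χ P w * γ (ψ P - U P)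
        + χ P * (deriv γ (ψ P - U P) * (fderiv ℝ ψ P w - g P))) := by
  have hdγ : Continuous (deriv γ) := hγ.continuous_deriv (by simp)
  have hcw : ∀ {f : ℝ × ℝ → ℝ}, ContDiff ℝ ∞ f → Continuous fun P => fderiv ℝ f P w :=
    fun hf => (hf.continuous_fderiv (by simp)).clm_apply continuous_const
  have hW : Continuous fun P => ψ P - U P := hψ.continuous.sub hU
  have h1 := integrable_comp_mul hv hvL hη (((hcw hχ).mul (hγ.continuous.comp hW)).add
    (hχ.continuous.mul ((hdγ.comp hW).mul (hcw hψ))))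
    ((hχc.fderiv_apply ℝ w).mul_right.add hχc.mul_right)
  have h2 := (integrable_comp_mul hv hvL hη (hχ.continuous.mul (hdγ.comp hW))
    hχc.mul_right).mul_bdd (c := L') hg.aestronglyMeasurable (ae_of_all _ hgL)
  refine (h1.sub h2).congr (ae_of_all _ fun P => ?_)
  simp only [Pi.sub_apply, Pi.mul_apply, Pi.add_apply, Function.comp]
  ring

/-! ### The entropy inequality gives a viscosity supersolution -/

theorem isEntropyPair_quadratic (p A : ℝ) : IsEntropyPair burgersFlux
    (fun r => (r - p) ^ 2 / 2 + A) (fun r => p * ((r - p) ^ 2 / 2 + A) + (r - p) ^ 3 / 3) where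
  convex := by
    have h : ConvexOn ℝ univ fun r : ℝ => (r - p) ^ 2 :=
      (Even.convexOn_pow (n := 2) (by norm_num)).translate_left (-p) |>.congr
        (fun r _ => by simp [sub_eq_add_neg])
    have h2 := (h.smul (c := (1 / 2 : ℝ)) (by norm_num)).add_const A
    exact h2.congr fun r _ => by simp; ring
  primitive v w := by
    have h1 : ∀ r, deriv burgersFlux r = r := fun r => by
      have h : HasDerivAt burgersFlux ((2 : ℕ) * r ^ (2 - 1) / 2) r :=
        (hasDerivAt_pow 2 r).div_const 2
      rw [h.deriv]
      norm_num
    have h2 : ∀ r, HasDerivAt (fun r : ℝ => (r - p) ^ 2 / 2 + A) (r - p) r := fun r => by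
      have h := (((hasDerivAt_id r).sub_const p).pow 2).div_const 2 |>.add_const A
      convert! h using 1
      simp
    have h3 : ∀ r, HasDerivAt (fun r : ℝ => p * ((r - p) ^ 2 / 2 + A) + (r - p) ^ 3 / 3)
        ((r - p) * r) r := fun r => by
      have h := ((h2 r).const_mul p).add ((((hasDerivAt_id r).sub_const p).pow 3).div_const 3)
      convert! h using 1
      simp
      ring
    simp only [h1, (h2 _).deriv]
    rw [intervalIntegral.integral_eq_sub_of_hasDerivAt (fun r _ => h3 r)
      (Continuous.intervalIntegrable (by fun_prop) _ _)]

/-- The potential of an entropy solution is a viscosity supersolution of `∂ₜU + (∂ₓU)² / 2 = 0`. The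
proof tests the entropy inequality for a quadratic entropy centred at `∂ₓψ` with a
function of `ψ - U`, as De Lellis, Otto and Westdickenberg do. -/
theorem IsPotential.viscosity_supersolution {M L : ℝ} {K : ℝ≥0} {v U : ℝ × ℝ → ℝ}
    (hv : IsPlaneSolution M L v) (hU : IsPotential K v U) {ψ : ℝ × ℝ → ℝ} (hψ : ContDiff ℝ ∞ ψ)
    {P₀ : ℝ × ℝ} (h0 : 0 < P₀.2)
    (hmin : ∀ P : ℝ × ℝ, 0 ≤ P.2 → U P₀ - ψ P₀ ≤ U P - ψ P) :
    0 ≤ fderiv ℝ ψ P₀ (0, 1) + fderiv ℝ ψ P₀ (1, 0) ^ 2 / 2 := by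
  by_contra! hneg
  set p := fderiv ℝ ψ P₀ (1, 0) with hp
  -- perturb `ψ` so that the minimum becomes strict
  let d : ℝ × ℝ → ℝ := fun P => (P.1 - P₀.1) ^ 2 + (P.2 - P₀.2) ^ 2
  have hdd : ContDiff ℝ ∞ d := by fun_prop
  have hd0 : fderiv ℝ d P₀ = 0 := by
    refine IsLocalMin.fderiv_eq_zero (Eventually.of_forall fun P => ?_)
    have h1 : d P₀ = 0 := by simp [d]
    rw [h1]
    positivity
  let ψ₁ : ℝ × ℝ → ℝ := fun P => ψ P - d P
  have hψ₁ : ContDiff ℝ ∞ ψ₁ := hψ.sub hdd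
  have hfd0 : fderiv ℝ ψ₁ P₀ = fderiv ℝ ψ P₀ := by
    have h1 : HasFDerivAt ψ₁ (fderiv ℝ ψ P₀ - fderiv ℝ d P₀) P₀ :=
      ((hψ.differentiable (by simp)) P₀).hasFDerivAt.sub
        ((hdd.differentiable (by simp)) P₀).hasFDerivAt
    rw [h1.fderiv, hd0, sub_zero]
  have hcw : ∀ w, Continuous fun P => fderiv ℝ ψ₁ P w :=
    fun w => (hψ₁.continuous_fderiv (by simp)).clm_apply continuous_const
  let X : ℝ × ℝ → ℝ := fun P => fderiv ℝ ψ₁ P (1, 0)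
  let τ : ℝ × ℝ → ℝ := fun P => fderiv ℝ ψ₁ P (0, 1) + p * X P - p ^ 2 / 2
  have hXc : Continuous X := hcw _
  have hτc : Continuous τ := ((hcw _).add (continuous_const.mul hXc)).sub continuous_const
  have hX0 : X P₀ = p := by simp only [X, hfd0, hp]
  have hτ0 : τ P₀ = fderiv ℝ ψ P₀ (0, 1) + p ^ 2 / 2 := by
    simp only [τ, hX0, hfd0]
    ring
  set A := -τ P₀ / 2 with hA
  have hA0 : 0 < A := by rw [hA, hτ0]; linarith
  have hev : ∀ᶠ P in 𝓝 P₀, (X P - p) ^ 2 / 3 + (τ P + A) / 2 < 0 ∧ τ P < 0 ∧ 0 < P.2 := by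
    refine (ContinuousAt.eventually_lt (f := fun P => (X P - p) ^ 2 / 3 + (τ P + A) / 2)
      (g := fun _ => (0 : ℝ)) (by fun_prop) (by fun_prop) ?_).and
      ((hτc.continuousAt.eventually_lt continuousAt_const ?_).and
        (continuousAt_const.eventually_lt continuousAt_snd h0))
    · rw [hX0]
      linarith
    · linarith
  obtain ⟨r, hr0, hr⟩ := Metric.eventually_nhds_iff_ball.1 hev
  let χ : ContDiffBump P₀ := ⟨r / 2, r, by positivity, by linarith⟩
  -- The cutoff `γ(ψ₁ - U + const)` lives where `dist P P₀ ^ 2 < σ`, inside the ball on which `χ = 1`;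
  -- `γ'(σ) > 0` makes the weight positive at `P₀`.
  obtain ⟨σ, ⟨hσ0, hσr⟩, hσ⟩ : ∃ σ ∈ Ioo 0 ((r / 2) ^ 2), 0 < deriv expNegInvGlue σ := by
    obtain ⟨σ, h1, h2⟩ := exists_deriv_eq_slope expNegInvGlue (a := 0) (b := (r / 2) ^ 2)
      (by positivity) (expNegInvGlue.contDiff (n := 0)).continuous.continuousOn
      ((expNegInvGlue.contDiff (n := 1)).differentiable one_ne_zero).differentiableOn
    refine ⟨σ, h1, ?_⟩
    rw [h2, expNegInvGlue.zero]
    have := expNegInvGlue.pos_of_pos (x := (r / 2) ^ 2) (by positivity)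
    simp only [sub_zero]
    positivity
  set γ := expNegInvGlue
  have hγ : ContDiff ℝ ∞ γ := expNegInvGlue.contDiff
  have hdγ : Continuous (deriv γ) := hγ.continuous_deriv (by simp)
  have hdγ0 : ∀ x, 0 ≤ deriv γ x := fun x => expNegInvGlue.monotone.deriv_nonneg
  let Ψ : ℝ × ℝ → ℝ := fun P => ψ₁ P + (U P₀ - ψ P₀ + σ)
  have hΨ : ContDiff ℝ ∞ Ψ := hψ₁.add contDiff_const
  have hfΨ : ∀ P, fderiv ℝ Ψ P = fderiv ℝ ψ₁ P := fun P => fderiv_add_const _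
  have hW : ∀ P : ℝ × ℝ, 0 ≤ P.2 → Ψ P - U P ≤ σ - dist P P₀ ^ 2 := by
    intro P hP
    have h1 := hmin P hP
    have h2 : dist P P₀ ^ 2 ≤ d P := by
      simp only [d, Prod.dist_eq, Real.dist_eq]
      rcases max_choice |P.1 - P₀.1| |P.2 - P₀.2| with h | h <;> rw [h, sq_abs] <;> nlinarith
    simp only [Ψ, ψ₁]
    linarith
  -- the entropy pair and the test functions
  let η : ℝ → ℝ := fun r => (r - p) ^ 2 / 2 + A
  let q : ℝ → ℝ := fun r => p * ((r - p) ^ 2 / 2 + A) + (r - p) ^ 3 / 3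
  have hη : Continuous η := by fun_prop
  have hq : Continuous q := by fun_prop
  let S : Set (ℝ × ℝ) := univ ×ˢ Ioi (0 : ℝ)
  have hS : MeasurableSet S := MeasurableSet.univ.prod measurableSet_Ioi
  let Φ : ℕ → ℝ × ℝ → ℝ := fun n P => χ P * γ (Ψ P - mollify (shrinkingBump n) U P)
  have hΦ : ∀ n, ContDiff ℝ ∞ (Φ n) := fun n => χ.contDiff.mul
    (hγ.comp (hΨ.sub (contDiff_mollify _ hU.lipschitz.continuous.locallyIntegrable)))
  have hχ0 : ∀ P, P ∉ Metric.ball P₀ r → χ P = 0 := fun P hP => by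
    rw [← Function.notMem_support, χ.support_eq]
    exact hP
  have hΦc : ∀ n, HasCompactSupport (Φ n) := fun n => χ.hasCompactSupport.mul_right
  have hI : ∀ n, 0 ≤ (∫ P in S, η (v P) * fderiv ℝ (Φ n) P (0, 1))
      + ∫ P in S, q (v P) * fderiv ℝ (Φ n) P (1, 0) := by
    intro n
    have hc : ∀ w, Continuous fun P => fderiv ℝ (Φ n) P w :=
      fun w => ((hΦ n).continuous_fderiv (by simp)).clm_apply continuous_const
    rw [← integral_add (integrable_comp_mul hv.measurable hv.abs_le hη (hc _)
      ((hΦc n).fderiv_apply ℝ _)).integrableOn (integrable_comp_mul hv.measurable hv.abs_le hq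
        (hc _) ((hΦc n).fderiv_apply ℝ _)).integrableOn]
    refine hv.entropy η q (isEntropyPair_quadratic p A) hη hq (Φ n) (hΦ n) (hΦc n)
      (fun P => mul_nonneg χ.nonneg (expNegInvGlue.nonneg _)) fun x => ?_
    have : ((x, 0) : ℝ × ℝ) ∉ Metric.ball P₀ r := fun h => lt_irrefl _ (hr _ h).2.2
    simp only [Φ, hχ0 _ this, zero_mul]
  have hlim_t := tendsto_integral_fderiv_cutoff hv.measurable hv.abs_le hη hU.lipschitz
    (measurable_timeComponent hv.measurable) (abs_timeComponent_le hv.abs_le)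
    hU.hasLineDerivAt_snd χ.contDiff χ.hasCompactSupport hΨ hγ S
  have hlim_x := tendsto_integral_fderiv_cutoff hv.measurable hv.abs_le hq hU.lipschitz
    hv.measurable hv.abs_le
    hU.hasLineDerivAt_fst χ.contDiff χ.hasCompactSupport hΨ hγ S
  have hnonneg := ge_of_tendsto (hlim_t.add hlim_x) (Eventually.of_forall hI)
  -- the derivatives of the cutoff do not contribute
  have hχ' : ∀ P ∈ S, ∀ w, fderiv ℝ χ P w * γ (Ψ P - U P) = 0 := by
    intro P hP w
    by_cases hd : P ∈ Metric.ball P₀ (r / 2)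
    · have h1 : (χ : ℝ × ℝ → ℝ) =ᶠ[𝓝 P] fun _ => 1 := by
        filter_upwards [Metric.isOpen_ball.mem_nhds hd] with Q hQ
        exact χ.one_of_mem_closedBall (Metric.ball_subset_closedBall hQ)
      rw [h1.fderiv_eq]
      simp
    · have h1 := hW P (mem_Ioi.1 hP.2).le
      have h2 : r / 2 ≤ dist P P₀ := not_lt.1 hd
      have h3 : γ (Ψ P - U P) = 0 := expNegInvGlue.zero_of_nonpos (by nlinarith)
      rw [h3, mul_zero]
  let k : ℝ × ℝ → ℝ := fun P => χ P * deriv γ (Ψ P - U P) * (A * -τ P)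
  have hkc : Continuous k := (χ.continuous.mul (hdγ.comp
    (hΨ.continuous.sub hU.lipschitz.continuous))).mul (continuous_const.mul hτc.neg)
  have hkcs : HasCompactSupport k := χ.hasCompactSupport.mul_right.mul_right
  have hk_pos : 0 < ∫ P, k P := by
    refine hkc.integral_pos_of_hasCompactSupport_nonneg_nonzero hkcs (fun P => ?_) (x := P₀) ?_
    · by_cases hP : P ∈ Metric.ball P₀ r
      · have h1 := (hr P hP).2.1
        exact mul_nonneg (mul_nonneg χ.nonneg (hdγ0 _)) (mul_nonneg hA0.le (by linarith))
      · simp only [k, hχ0 P hP, zero_mul]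
        exact le_rfl
    · have h1 : Ψ P₀ - U P₀ = σ := by simp only [Ψ, ψ₁, d]; ring
      have h2 : χ P₀ = 1 :=
        χ.one_of_mem_closedBall (Metric.mem_closedBall_self χ.rIn_pos.le)
      simp only [k, h1, h2]
      have h3 : τ P₀ ≠ 0 := by rw [hτ0]; exact hneg.ne
      exact mul_ne_zero (mul_ne_zero one_ne_zero hσ.ne') (mul_ne_zero hA0.ne' (neg_ne_zero.2 h3))
  have hkS : ∫ P in S, k P = ∫ P, k P := by
    refine setIntegral_eq_integral_of_forall_compl_eq_zero fun P hP => ?_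
    have : P ∉ Metric.ball P₀ r := fun h => hP ⟨mem_univ _, (hr P h).2.2⟩
    simp only [k, hχ0 P this, zero_mul]
  -- the integrand is at most `-k`
  have hpt : ∀ P ∈ S, η (v P) * (fderiv ℝ χ P (0, 1) * γ (Ψ P - U P)
        + χ P * (deriv γ (Ψ P - U P) * (fderiv ℝ Ψ P (0, 1) - timeComponent v P)))
      + q (v P) * (fderiv ℝ χ P (1, 0) * γ (Ψ P - U P)
        + χ P * (deriv γ (Ψ P - U P) * (fderiv ℝ Ψ P (1, 0) - v P))) ≤ -k P := by
    intro P hP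
    rw [hχ' P hP, hχ' P hP, zero_add, zero_add, hfΨ]
    have ht : timeComponent v P = -(v P ^ 2 / 2) := by
      simp only [timeComponent, mem_Ioi.1 hP.2, if_true]
    by_cases hPb : P ∈ Metric.ball P₀ r
    · obtain ⟨h1, h2, -⟩ := hr P hPb
      have h3 : 0 ≤ χ P * deriv γ (Ψ P - U P) := mul_nonneg χ.nonneg (hdγ0 _)
      have h4 : η (v P) * (fderiv ℝ ψ₁ P (0, 1) - timeComponent v P) + q (v P) * (X P - v P)
          ≤ A * τ P := by
        -- with `z = v - p`, `y = X - p` the left side is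
        -- `-z⁴/12 + z³y/3 + z²(τ + A)/2 + Aτ ≤ z²(y²/3 + (τ + A)/2) + Aτ`
        have h5 : fderiv ℝ ψ₁ P (0, 1) = τ P - p * X P + p ^ 2 / 2 := by simp only [τ]; ring
        rw [ht, h5]
        simp only [η, q]
        linarith [mul_nonneg (sq_nonneg (v P - p)) (sq_nonneg (v P - p - 2 * (X P - p))),
          mul_nonneg (sq_nonneg (v P - p)) (neg_nonneg.2 h1.le)]
      have h6 := mul_le_mul_of_nonneg_left h4 h3
      simp only [k]
      change _ + q (v P) * (χ P * (deriv γ (Ψ P - U P) * (X P - v P))) ≤ _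
      linarith
    · simp [k, hχ0 P hPb]
  have hi_t := (integrable_fderiv_cutoff hv.measurable hv.abs_le hη hU.lipschitz.continuous
    (measurable_timeComponent hv.measurable) (abs_timeComponent_le hv.abs_le) χ.contDiff
    χ.hasCompactSupport hΨ hγ (0, 1)).integrableOn (s := S)
  have hi_x := (integrable_fderiv_cutoff hv.measurable hv.abs_le hq hU.lipschitz.continuous
    hv.measurable hv.abs_le χ.contDiff χ.hasCompactSupport hΨ hγ (1, 0)).integrableOn (s := S)
  rw [← integral_add hi_t hi_x] at hnonneg
  have h1 := setIntegral_mono_on (hi_t.add hi_x)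
    (hkc.integrable_of_hasCompactSupport hkcs).neg.integrableOn hS hpt
  have h2 : ∫ P in S, (-k) P = -∫ P in S, k P := integral_neg _
  linarith [hnonneg.trans h1]

/-! ### Comparison with smooth subsolutions -/

theorem hasDerivAt_sqrt_one_add_sq (x : ℝ) :
    HasDerivAt (fun x : ℝ => √(1 + x ^ 2)) (x / √(1 + x ^ 2)) x := by
  have h1 : HasDerivAt (fun x : ℝ => 1 + x ^ 2) (2 * x) x := by
    simpa using (hasDerivAt_pow 2 x).const_add 1
  convert! h1.sqrt (by positivity) using 1
  field_simp

theorem abs_div_sqrt_one_add_sq_le (x : ℝ) : |x / √(1 + x ^ 2)| ≤ 1 := by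
  rw [abs_div, abs_of_nonneg (Real.sqrt_nonneg _), div_le_one (by positivity)]
  exact Real.abs_le_sqrt (by linarith)

/-- Comparison: a smooth subsolution of `∂ₜζ + (∂ₓζ)² / 2 ≤ 0` that lies below the potential `U`
initially stays below it. The linear growth bound contains the initial condition. -/
theorem IsPotential.comparison {M L : ℝ} {K : ℝ≥0} {v U : ℝ × ℝ → ℝ}
    (hv : IsPlaneSolution M L v) (hU : IsPotential K v U) {ζ : ℝ × ℝ → ℝ} (hζ : ContDiff ℝ ∞ ζ)
    (hsub : ∀ P : ℝ × ℝ, 0 < P.2 → fderiv ℝ ζ P (0, 1) + fderiv ℝ ζ P (1, 0) ^ 2 / 2 ≤ 0)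
    {B C : ℝ} (hB : ∀ P, |fderiv ℝ ζ P (1, 0)| ≤ B)
    (hC : ∀ P : ℝ × ℝ, 0 ≤ P.2 → ζ P ≤ U P + C * P.2) (P : ℝ × ℝ) (hP : 0 ≤ P.2) :
    ζ P ≤ U P := by
  by_contra! hlt
  set gap := ζ P - U P with hgap
  have hgap0 : 0 < gap := sub_pos.2 hlt
  have hB0 : 0 ≤ B := (abs_nonneg _).trans (hB 0)
  -- `κ √(1 + x²)` makes the difference coercive in `x`, at a cost of at most `ε` in the equation;
  -- `ε (t + t²)` makes it coercive in `t` and the subsolution strict.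
  obtain ⟨ε, hε0, hε⟩ : ∃ ε > 0, ε * (P.2 + P.2 ^ 2) < gap / 2 := by
    refine ⟨gap / (4 * (P.2 + P.2 ^ 2 + 1)), by positivity, ?_⟩
    rw [div_mul_eq_mul_div, div_lt_div_iff₀ (by positivity) (by positivity)]
    nlinarith [sq_nonneg P.2]
  obtain ⟨κ, hκ0, hκ1, hκ2⟩ : ∃ κ > 0, κ * √(1 + P.1 ^ 2) < gap / 2 ∧ κ * B + κ ^ 2 / 2 < ε := by
    have h1 : Tendsto (fun κ : ℝ => κ * √(1 + P.1 ^ 2)) (𝓝[>] 0) (𝓝 0) := by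
      refine Tendsto.mono_left ?_ nhdsWithin_le_nhds
      simpa using (continuous_mul_const √(1 + P.1 ^ 2)).tendsto 0
    have h2 : Tendsto (fun κ : ℝ => κ * B + κ ^ 2 / 2) (𝓝[>] 0) (𝓝 0) := by
      refine Tendsto.mono_left ?_ nhdsWithin_le_nhds
      simpa using (by fun_prop : Continuous fun κ : ℝ => κ * B + κ ^ 2 / 2).tendsto 0
    obtain ⟨κ, h3, h4, h5⟩ := ((h1.eventually_lt_const (half_pos hgap0)).and
      ((h2.eventually_lt_const hε0).and self_mem_nhdsWithin)).exists
    exact ⟨κ, h5, h3, h4⟩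
  let ψ : ℝ × ℝ → ℝ := fun Q => ζ Q - (ε * (Q.2 + Q.2 ^ 2) + κ * √(1 + Q.1 ^ 2))
  have hψ : ContDiff ℝ ∞ ψ := by
    refine hζ.sub (ContDiff.add (by fun_prop) (contDiff_const.mul (ContDiff.sqrt (by fun_prop) ?_)))
    intro Q
    positivity
  let g : ℝ × ℝ → ℝ := fun Q => U Q - ψ Q
  have hg : Continuous g := hU.lipschitz.continuous.sub hψ.continuous
  have hgP : g P < 0 := by simp only [g, ψ]; linarith
  have hlow : ∀ Q : ℝ × ℝ, 0 ≤ Q.2 → -|C| * Q.2 + ε * (Q.2 + Q.2 ^ 2) + κ * √(1 + Q.1 ^ 2) ≤ g Q := by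
    intro Q hQ
    have h1 := hC Q hQ
    have h2 := mul_le_mul_of_nonneg_right (le_abs_self C) hQ
    simp only [g, ψ]
    linarith
  -- `g` is coercive on the half-plane, so that it has a minimum there
  obtain ⟨P₀, hP₀, hmin⟩ : ∃ P₀ ∈ {Q : ℝ × ℝ | 0 ≤ Q.2}, IsMinOn g {Q : ℝ × ℝ | 0 ≤ Q.2} P₀ := by
    refine hg.continuousOn.exists_isMinOn' (isClosed_le continuous_const continuous_snd)
      (x₀ := P) hP ?_
    rw [eventually_inf_principal]
    set R := |C| / ε + C ^ 2 / (4 * ε * κ) with hR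
    filter_upwards [(isCompact_closedBall (0 : ℝ × ℝ) R).compl_mem_cocompact] with Q hQ hQ0
    refine hgP.le.trans (le_trans ?_ (hlow Q hQ0))
    have hQ0' : 0 ≤ Q.2 := hQ0
    have hR1 : |C| / ε ≤ R := le_add_of_nonneg_right (by positivity)
    have hR2 : C ^ 2 / (4 * ε * κ) ≤ R := le_add_of_nonneg_left (by positivity)
    have h1 : R < max |Q.1| |Q.2| := by
      rw [mem_compl_iff, mem_closedBall_zero_iff, not_le] at hQ
      exact hQ
    have h3 : |Q.1| ≤ √(1 + Q.1 ^ 2) := Real.abs_le_sqrt (by linarith)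
    rcases lt_max_iff.1 h1 with h | h
    · have h4 : C ^ 2 ≤ 4 * ε * (κ * √(1 + Q.1 ^ 2)) := by
        have := (hR2.trans h.le).trans h3
        rw [div_le_iff₀ (by positivity)] at this
        linarith
      have h5 : 0 ≤ ε * (-|C| * Q.2 + ε * Q.2 ^ 2 + κ * √(1 + Q.1 ^ 2)) := by
        nlinarith [sq_nonneg (2 * ε * Q.2 - |C|), sq_abs C]
      have h6 := nonneg_of_mul_nonneg_right h5 hε0
      nlinarith
    · rw [abs_of_nonneg hQ0'] at h
      have h4 : |C| ≤ ε * Q.2 := by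
        have := hR1.trans h.le
        rw [div_le_iff₀ hε0] at this
        linarith
      have h5 : 0 ≤ κ * √(1 + Q.1 ^ 2) := by positivity
      nlinarith [mul_le_mul_of_nonneg_right h4 hQ0']
  have hg0 : g P₀ < 0 := (hmin hP).trans_lt hgP
  have ht0 : 0 < P₀.2 := by
    refine lt_of_le_of_ne hP₀ fun h => ?_
    have h1 := hlow P₀ hP₀
    rw [← h] at h1
    have : 0 ≤ κ * √(1 + P₀.1 ^ 2) := by positivity
    linarith
  have hvis := hU.viscosity_supersolution hv hψ ht0 fun Q hQ => hmin hQ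
  have hd := hζ.differentiable (by simp)
  have hft : fderiv ℝ ψ P₀ (0, 1) = fderiv ℝ ζ P₀ (0, 1) - ε * (1 + 2 * P₀.2) := by
    have h1 := hasDerivAt_slice_snd (hψ.differentiable (by simp)) P₀.1 P₀.2
    have h2 : HasDerivAt (fun r : ℝ => ε * (r + r ^ 2) + κ * √(1 + P₀.1 ^ 2))
        (ε * (1 + 2 * P₀.2)) P₀.2 := by
      simpa using (((hasDerivAt_id P₀.2).add (hasDerivAt_pow 2 P₀.2)).const_mul ε).add_const
        (κ * √(1 + P₀.1 ^ 2))
    exact h1.unique ((hasDerivAt_slice_snd hd P₀.1 P₀.2).sub h2)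
  have hfx : fderiv ℝ ψ P₀ (1, 0)
      = fderiv ℝ ζ P₀ (1, 0) - κ * (P₀.1 / √(1 + P₀.1 ^ 2)) := by
    have h1 := hasDerivAt_slice_fst (hψ.differentiable (by simp)) P₀.1 P₀.2
    have h2 : HasDerivAt (fun y : ℝ => ε * (P₀.2 + P₀.2 ^ 2) + κ * √(1 + y ^ 2))
        (κ * (P₀.1 / √(1 + P₀.1 ^ 2))) P₀.1 :=
      ((hasDerivAt_sqrt_one_add_sq P₀.1).const_mul κ).const_add _
    exact h1.unique ((hasDerivAt_slice_fst hd P₀.1 P₀.2).sub h2)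
  rw [hft, hfx] at hvis
  have h1 := hsub P₀ ht0
  have h2 := abs_div_sqrt_one_add_sq_le P₀.1
  set θ := P₀.1 / √(1 + P₀.1 ^ 2)
  set X := fderiv ℝ ζ P₀ (1, 0)
  have h3 : |X * θ| ≤ B * 1 := by
    rw [abs_mul]
    exact mul_le_mul (hB P₀) h2 (abs_nonneg _) hB0
  have h4 : θ ^ 2 ≤ 1 := by rw [← sq_abs]; exact pow_le_one₀ (abs_nonneg _) h2
  have h5 : -(κ * (X * θ)) ≤ κ * B := by nlinarith [(abs_le.1 h3).1]
  have h6 : κ ^ 2 * θ ^ 2 ≤ κ ^ 2 := mul_le_of_le_one_right (sq_nonneg _) h4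
  nlinarith [mul_pos hε0 ht0]

/-! ### Semiconcavity and the maximum principle -/

theorem LipschitzWith.abs_sub_le_fst {K : ℝ≥0} {U : ℝ × ℝ → ℝ} (hU : LipschitzWith K U)
    (x y t : ℝ) : |U (x, t) - U (y, t)| ≤ K * |x - y| := by
  have := hU.dist_le_mul (x, t) (y, t)
  rwa [Prod.dist_eq, dist_self, max_eq_left dist_nonneg, Real.dist_eq, Real.dist_eq] at this

theorem LipschitzWith.abs_sub_le_snd {K : ℝ≥0} {U : ℝ × ℝ → ℝ} (hU : LipschitzWith K U)
    (x s t : ℝ) : |U (x, s) - U (x, t)| ≤ K * |s - t| := by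
  have := hU.dist_le_mul (x, s) (x, t)
  rwa [Prod.dist_eq, dist_self, max_eq_right dist_nonneg, Real.dist_eq, Real.dist_eq] at this

theorem fderiv_eq_of_hasLineDerivAt {f : ℝ × ℝ → ℝ} {P v : ℝ × ℝ} {c : ℝ}
    (hf : DifferentiableAt ℝ f P) (h : HasLineDerivAt ℝ f c P v) : fderiv ℝ f P v = c :=
  (hf.hasFDerivAt.hasLineDerivAt v).unique h

theorem fderiv_comp_add_right_apply {f : ℝ × ℝ → ℝ} (P Q v : ℝ × ℝ) :
    fderiv ℝ (fun P => f (P + Q)) P v = fderiv ℝ f (P + Q) v := by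
  rw [fderiv_comp_add_right]

/-- The potential of a weak solution is a uniform limit of smooth subsolutions of
`∂ₜS + (∂ₓS)² / 2 ≤ 0` in `t > 0`: the Hamiltonian is convex, so that mollification
preserves subsolutions. -/
theorem IsPotential.exists_smooth_subsolution {M L : ℝ} {K : ℝ≥0} {v U : ℝ × ℝ → ℝ}
    (hv : IsPlaneSolution M L v) (hU : IsPotential K v U) {ε : ℝ} (hε : 0 < ε) :
    ∃ S : ℝ × ℝ → ℝ, ContDiff ℝ ∞ S ∧
      (∀ P : ℝ × ℝ, 0 < P.2 → fderiv ℝ S P (0, 1) + fderiv ℝ S P (1, 0) ^ 2 / 2 ≤ 0) ∧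
      (∀ P, |fderiv ℝ S P (1, 0)| ≤ L) ∧ ∀ P, |S P - U P| ≤ ε := by
  set r : ℝ := ε / (2 * K + 1) with hr
  have hr0 : 0 < r := by positivity
  let φ : ContDiffBump (0 : ℝ × ℝ) := ⟨r / 2, r, by positivity, by linarith⟩
  have hm := contDiff_mollify φ hU.lipschitz.continuous.locallyIntegrable
  have hd := hm.differentiable (by simp)
  have hx : ∀ P, fderiv ℝ (fun P => mollify φ U (P + (0, r))) P (1, 0)
      = mollify φ v (P + (0, r)) := fun P => by
    rw [fderiv_comp_add_right_apply]
    exact fderiv_eq_of_hasLineDerivAt (hd _) (hU.hasLineDerivAt_fst φ _)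
  have ht : ∀ P, fderiv ℝ (fun P => mollify φ U (P + (0, r))) P (0, 1)
      = mollify φ (timeComponent v) (P + (0, r)) := fun P => by
    rw [fderiv_comp_add_right_apply]
    exact fderiv_eq_of_hasLineDerivAt (hd _) (hU.hasLineDerivAt_snd φ _)
  -- The shift in time by the radius `r` lets the mollification at times `t > 0` see only `t > 0`.
  refine ⟨fun P => mollify φ U (P + (0, r)), hm.comp (contDiff_id.add contDiff_const),
    fun P hP => ?_, fun P => ?_, fun P => ?_⟩
  · rw [hx, ht]
    have h1 : mollify φ (fun Q => -2 * timeComponent v Q) (P + (0, r))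
        = -2 * mollify φ (timeComponent v) (P + (0, r)) := by
      simp only [mollify]
      rw [← integral_const_mul]
      congr 1
      funext Q
      ring
    have h2 := sq_mollify_le φ hv.measurable hv.abs_le (h := fun Q => -2 * timeComponent v Q)
      ((measurable_timeComponent hv.measurable).const_mul _) (L' := 2 * (L ^ 2 / 2))
      (fun Q => by
        rw [abs_mul]
        norm_num
        have := abs_timeComponent_le hv.abs_le Q
        linarith) (P := P + (0, r)) (fun Q hQ => by
          have h3 : dist Q.2 (P.2 + r) < r := (le_max_right _ _).trans_lt hQ
          have h4 : 0 < Q.2 := by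
            rw [Real.dist_eq, abs_lt] at h3
            linarith
          simp only [timeComponent, h4, if_true]
          linarith)
    rw [h1] at h2
    linarith
  · rw [hx]
    exact abs_mollify_le φ hv.abs_le _
  · have h1 := abs_le.1 (abs_mollify_sub_le φ hU.lipschitz (P + (0, r)))
    have h2 := hU.lipschitz.dist_le_mul (P + (0, r)) P
    have h3 : dist (P + (0, r)) P = r := by
      rw [dist_eq_norm, add_sub_cancel_left, Prod.norm_def]
      simp [hr0.le]
    rw [h3, Real.dist_eq] at h2
    have h4 := abs_le.1 h2
    have h5 : 2 * K * r ≤ ε := by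
      rw [hr, ← mul_div_assoc, div_le_iff₀ (by positivity)]
      nlinarith [K.2]
    change -(K * r) ≤ _ ∧ _ ≤ K * r at h1
    rw [abs_le]
    constructor <;> linarith [h1.1, h1.2, h4.1, h4.2]

theorem hasDerivAt_comp_shear {S : ℝ × ℝ → ℝ} (hS : Differentiable ℝ S) (k x t : ℝ) :
    HasDerivAt (fun y => S (y + k * t, t)) (fderiv ℝ S (x + k * t, t) (1, 0)) x ∧
    HasDerivAt (fun r => S (x + k * r, r))
      (k * fderiv ℝ S (x + k * t, t) (1, 0) + fderiv ℝ S (x + k * t, t) (0, 1)) t := by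
  constructor
  · have h1 : HasDerivAt (fun y : ℝ => (y + k * t, t)) ((1 : ℝ), (0 : ℝ)) x :=
      ((hasDerivAt_id x).add_const _).prodMk (hasDerivAt_const x t)
    exact HasFDerivAt.comp_hasDerivAt (f := fun y : ℝ => (y + k * t, t)) x (hS _).hasFDerivAt h1
  · have h1 : HasDerivAt (fun r : ℝ => (x + k * r, r)) (k, (1 : ℝ)) t := by
      have h2 : HasDerivAt (fun r : ℝ => x + k * r) k t := by
        simpa using ((hasDerivAt_id t).const_mul k).const_add x
      exact h2.prodMk (hasDerivAt_id t)
    have h3 : ((k, 1) : ℝ × ℝ) = k • ((1, 0) : ℝ × ℝ) + (0, 1) := by ext <;> simp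
    have h4 := HasFDerivAt.comp_hasDerivAt (f := fun r : ℝ => (x + k * r, r)) t
      (hS (x + k * t, t)).hasFDerivAt h1
    rw [h3, map_add, map_smul, smul_eq_mul] at h4
    exact h4

/-- One-sided second-order estimate for the potential, with the sharp constant `1 / t`. With
`S` a smooth subsolution close to `U`, the average of two sheared copies of `S` minus
`l (1 - l) k² t / 2` is again a subsolution, and it agrees with `S` at `t = 0`. -/
theorem IsPotential.semiconcave {M L : ℝ} {K : ℝ≥0} {v U : ℝ × ℝ → ℝ}
    (hv : IsPlaneSolution M L v) (hU : IsPotential K v U) {l m : ℝ} (hl : 0 ≤ l) (hm : 0 ≤ m)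
    (hlm : l + m = 1) (k x : ℝ) {t : ℝ} (ht : 0 ≤ t) :
    l * U (x + m * k * t, t) + m * U (x + -(l * k) * t, t) - l * m * k ^ 2 * t / 2 ≤ U (x, t) := by
  refine le_of_forall_pos_le_add fun ε hε => ?_
  obtain ⟨S, hS, hsub, hSx, hSU⟩ := hU.exists_smooth_subsolution hv (half_pos hε)
  have hSd := hS.differentiable (by simp)
  let ζ : ℝ × ℝ → ℝ := fun P => l * S (P.1 + m * k * P.2, P.2)
    + m * S (P.1 + -(l * k) * P.2, P.2) - l * m * k ^ 2 * P.2 / 2 - ε / 2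
  have hζ : ContDiff ℝ ∞ ζ := by
    refine (((contDiff_const.mul (hS.comp ?_)).add (contDiff_const.mul (hS.comp ?_))).sub ?_).sub
      contDiff_const <;> fun_prop
  have hζd := hζ.differentiable (by simp)
  have hfx : ∀ P : ℝ × ℝ, fderiv ℝ ζ P (1, 0) = l * fderiv ℝ S (P.1 + m * k * P.2, P.2) (1, 0)
      + m * fderiv ℝ S (P.1 + -(l * k) * P.2, P.2) (1, 0) := fun P => by
    have h1 := ((((hasDerivAt_comp_shear hSd (m * k) P.1 P.2).1.const_mul l).add
      ((hasDerivAt_comp_shear hSd (-(l * k)) P.1 P.2).1.const_mul m)).sub_const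
        (l * m * k ^ 2 * P.2 / 2)).sub_const (ε / 2)
    exact (hasDerivAt_slice_fst hζd P.1 P.2).unique h1
  have hft : ∀ P : ℝ × ℝ, fderiv ℝ ζ P (0, 1)
      = l * (m * k * fderiv ℝ S (P.1 + m * k * P.2, P.2) (1, 0)
          + fderiv ℝ S (P.1 + m * k * P.2, P.2) (0, 1))
        + m * (-(l * k) * fderiv ℝ S (P.1 + -(l * k) * P.2, P.2) (1, 0)
          + fderiv ℝ S (P.1 + -(l * k) * P.2, P.2) (0, 1)) - l * m * k ^ 2 / 2 := fun P => by
    have h2 : HasDerivAt (fun r : ℝ => l * m * k ^ 2 * r / 2) (l * m * k ^ 2 / 2) P.2 := by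
      simpa using ((hasDerivAt_id P.2).const_mul (l * m * k ^ 2)).div_const 2
    have h1 := ((((hasDerivAt_comp_shear hSd (m * k) P.1 P.2).2.const_mul l).add
      ((hasDerivAt_comp_shear hSd (-(l * k)) P.1 P.2).2.const_mul m)).sub h2).sub_const (ε / 2)
    exact (hasDerivAt_slice_snd hζd P.1 P.2).unique h1
  have hl1 : l ≤ 1 := by linarith
  have hm1 : m ≤ 1 := by linarith
  have hle : ∀ a b c d : ℝ, a ≤ c → b ≤ d → l * a + m * b ≤ l * c + m * d := fun a b c d h1 h2 =>
    add_le_add (mul_le_mul_of_nonneg_left h1 hl) (mul_le_mul_of_nonneg_left h2 hm)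
  have hcomp := hU.comparison hv hζ (B := L) (C := K * |k|) (fun P hP => ?_) (fun P => ?_)
    (fun P hP => ?_) (x, t) ht
  · have h1 := (abs_le.1 (hSU (x + m * k * t, t))).1
    have h2 := (abs_le.1 (hSU (x + -(l * k) * t, t))).1
    have h3 := hle (U (x + m * k * t, t) - ε / 2) (U (x + -(l * k) * t, t) - ε / 2)
      (S (x + m * k * t, t)) (S (x + -(l * k) * t, t)) (by linarith) (by linarith)
    have h4 : l * (ε / 2) + m * (ε / 2) = ε / 2 := by rw [← add_mul, hlm, one_mul]
    simp only [ζ] at hcomp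
    linarith
  · have h1 := hsub (P.1 + m * k * P.2, P.2) hP
    have h2 := hsub (P.1 + -(l * k) * P.2, P.2) hP
    rw [hft, hfx]
    set p₁ := fderiv ℝ S (P.1 + m * k * P.2, P.2) (1, 0)
    set p₂ := fderiv ℝ S (P.1 + -(l * k) * P.2, P.2) (1, 0)
    have h3 := hle _ _ _ _ h1 h2
    have h4 : 0 ≤ l * m * (p₁ - p₂ - k) ^ 2 := by positivity
    have h5 : (l * p₁ + m * p₂) ^ 2 = l * p₁ ^ 2 + m * p₂ ^ 2 - l * m * (p₁ - p₂) ^ 2 := by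
      have : l = 1 - m := by linarith
      subst this
      ring
    rw [h5]
    nlinarith
  · rw [hfx]
    refine (abs_add_le _ _).trans ?_
    rw [abs_mul, abs_mul, abs_of_nonneg hl, abs_of_nonneg hm]
    refine (hle _ _ _ _ (hSx _) (hSx _)).trans (le_of_eq ?_)
    rw [← add_mul, hlm, one_mul]
  · have hkt : 0 ≤ K * |k| * P.2 := by positivity
    have key : ∀ a : ℝ, |a| ≤ |k| → S (P.1 + a * P.2, P.2) ≤ U P + K * |k| * P.2 + ε / 2 := by
      intro a ha
      have h1 := (abs_le.1 (hSU (P.1 + a * P.2, P.2))).2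
      have h2 := (abs_le.1 (hU.lipschitz.abs_sub_le_fst (P.1 + a * P.2) P.1 P.2)).2
      rw [add_sub_cancel_left, abs_mul, abs_of_nonneg hP] at h2
      have h3 : K * (|a| * P.2) ≤ K * (|k| * P.2) := by gcongr
      change _ - U P ≤ _ at h2
      linarith
    have h1 := hle _ _ _ _ (key (m * k) (by
      rw [abs_mul, abs_of_nonneg hm]; exact mul_le_of_le_one_left (abs_nonneg _) hm1))
      (key (-(l * k)) (by
        rw [abs_neg, abs_mul, abs_of_nonneg hl]; exact mul_le_of_le_one_left (abs_nonneg _) hl1))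
    rw [← add_mul, hlm, one_mul] at h1
    have h2 : 0 ≤ l * m * k ^ 2 * P.2 / 2 := by positivity
    simp only [ζ]
    linarith

/-- Oleĭnik's one-sided estimate, in integrated form. -/
theorem IsPotential.concaveOn {M L : ℝ} {K : ℝ≥0} {v U : ℝ × ℝ → ℝ}
    (hv : IsPlaneSolution M L v) (hU : IsPotential K v U) {t : ℝ} (ht : 0 < t) :
    ConcaveOn ℝ univ fun x => U (x, t) - x ^ 2 / (2 * t) := by
  refine ⟨convex_univ, fun y _ z _ l m hl hm hlm => ?_⟩
  have h1 := hU.semiconcave hv hl hm hlm ((y - z) / t) (l * y + m * z) ht.le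
  have hl' : l = 1 - m := by linarith
  have h2 : l * y + m * z + m * ((y - z) / t) * t = y := by
    rw [hl']; field_simp; ring
  have h3 : l * y + m * z + -(l * ((y - z) / t)) * t = z := by
    rw [hl']; field_simp; ring
  rw [h2, h3] at h1
  simp only [smul_eq_mul]
  have h4 : l * m * ((y - z) / t) ^ 2 * t / 2
      = l * (y ^ 2 / (2 * t)) + m * (z ^ 2 / (2 * t)) - (l * y + m * z) ^ 2 / (2 * t) := by
    rw [hl']; field_simp; ring
  linarith

/-- At almost every time, `U(·, t)` is a primitive of `v(·, t)`. -/
theorem IsPotential.ae_sub_eq_integral {M L : ℝ} {K : ℝ≥0} {v U : ℝ × ℝ → ℝ}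
    (hv : IsPlaneSolution M L v) (hU : IsPotential K v U) :
    ∀ᵐ t, ∀ x y, U (y, t) - U (x, t) = ∫ r in x..y, v (r, t) := by
  have h1 : ∀ᵐ P ∂(volume.restrict (univ ×ˢ univ)), Tendsto (fun n => mollify (shrinkingBump n) v P)
      atTop (𝓝 (v P)) := by
    rw [univ_prod_univ, Measure.restrict_univ]
    exact ae_tendsto_mollify (locallyIntegrable_of_abs_le hv.measurable hv.abs_le)
  have h2 := ae_ae_of_ae_univ_prod h1
  rw [Measure.restrict_univ] at h2
  filter_upwards [h2] with t ht x y
  have hvi := locallyIntegrable_of_abs_le (μ := volume) hv.measurable hv.abs_le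
  have hc : ∀ n, Continuous fun r => mollify (shrinkingBump n) v (r, t) := fun n =>
    (contDiff_mollify _ hvi).continuous.comp (by fun_prop)
  have h3 : ∀ n, ∫ r in x..y, mollify (shrinkingBump n) v (r, t)
      = mollify (shrinkingBump n) U (y, t) - mollify (shrinkingBump n) U (x, t) := by
    intro n
    have hd := (contDiff_mollify (shrinkingBump n)
      hU.lipschitz.continuous.locallyIntegrable).differentiable (by simp)
    refine intervalIntegral.integral_eq_sub_of_hasDerivAt
      (f := fun r => mollify (shrinkingBump n) U (r, t)) (fun r _ => ?_)
      ((hc n).intervalIntegrable _ _)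
    have h4 := hasDerivAt_slice_fst hd r t
    rwa [fderiv_eq_of_hasLineDerivAt (hd _) (hU.hasLineDerivAt_fst _ _)] at h4
  have h4 : Tendsto (fun n => ∫ r in x..y, mollify (shrinkingBump n) v (r, t)) atTop
      (𝓝 (∫ r in x..y, v (r, t))) := by
    refine intervalIntegral.tendsto_integral_filter_of_dominated_convergence (fun _ => L)
      (Eventually.of_forall fun n => (hc n).aestronglyMeasurable)
      (Eventually.of_forall fun n => ae_of_all _ fun r _ => abs_mollify_le _ hv.abs_le _)
      intervalIntegrable_const ?_
    filter_upwards [ht] with r hr _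
    exact hr
  simp only [h3] at h4
  exact tendsto_nhds_unique ((tendsto_mollify_of_continuous hU.lipschitz.continuous _).sub
    (tendsto_mollify_of_continuous hU.lipschitz.continuous _)) h4

theorem IsPotential.abs_sub_le_initial {M L : ℝ} {K : ℝ≥0} {v U : ℝ × ℝ → ℝ}
    (hv : IsPlaneSolution M L v) (hU : IsPotential K v U) (x y : ℝ) :
    |U (y, 0) - U (x, 0)| ≤ M * |y - x| := by
  have hdense := Measure.dense_of_ae (hU.ae_sub_eq_integral hv)
  have h1 := hdense.open_subset_closure_inter (isOpen_Iio (a := (0 : ℝ)))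
  have h2 : (0 : ℝ) ∈ closure (Iio 0 ∩ {t | ∀ x y, U (y, t) - U (x, t) = ∫ r in x..y, v (r, t)}) :=
    closure_minimal h1 isClosed_closure (by rw [closure_Iio (0 : ℝ)]; exact self_mem_Iic)
  have h3 : IsClosed {t | |U (y, t) - U (x, t)| ≤ M * |y - x|} := by
    have hc := hU.lipschitz.continuous
    exact isClosed_le (by fun_prop) continuous_const
  refine closure_minimal (fun t ht => ?_) h3 h2
  rw [mem_ofPred_eq, ht.2 x y, ← Real.norm_eq_abs]
  exact intervalIntegral.norm_integral_le_of_norm_le_const fun r _ =>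
    hv.abs_le_initial (r, t) (mem_Iio.1 ht.1).le

/-- The maximum principle, in integrated form. -/
theorem IsPotential.abs_sub_le {M L : ℝ} {K : ℝ≥0} {v U : ℝ × ℝ → ℝ}
    (hv : IsPlaneSolution M L v) (hU : IsPotential K v U) (x y : ℝ) {t : ℝ} (ht : 0 ≤ t) :
    |U (y, t) - U (x, t)| ≤ M * |y - x| := by
  have key : ∀ x h : ℝ, U (x + h, t) - U (x, t) ≤ M * |h| := by
    intro x h
    refine le_of_forall_pos_le_add fun ε hε => ?_
    obtain ⟨S, hS, hsub, hSx, hSU⟩ := hU.exists_smooth_subsolution hv (half_pos hε)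
    have hf : ∀ P w, fderiv ℝ (fun P : ℝ × ℝ => S (P + (h, 0)) - (M * |h| + ε / 2)) P w
        = fderiv ℝ S (P + (h, 0)) w := fun P w => by
      rw [fderiv_sub_const, fderiv_comp_add_right]
    have hcomp := hU.comparison hv (ζ := fun P : ℝ × ℝ => S (P + (h, 0)) - (M * |h| + ε / 2))
      ((hS.comp (contDiff_id.add contDiff_const)).sub contDiff_const) (B := L) (C := 2 * K)
      (fun P hP => ?_) (fun P => ?_) (fun P hP => ?_) (x, t) ht
    · have h1 := (abs_le.1 (hSU (x + h, t))).1
      simp only [Prod.mk_add_mk, add_zero] at hcomp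
      linarith
    · rw [hf, hf]
      exact hsub _ (by simpa using hP)
    · rw [hf]
      exact hSx _
    · obtain ⟨y, r⟩ := P
      have hr : 0 ≤ r := hP
      have h1 := (abs_le.1 (hSU (y + h, r))).2
      have h2 := (abs_le.1 (hU.lipschitz.abs_sub_le_snd (y + h) r 0)).2
      have h3 := (abs_le.1 (hU.lipschitz.abs_sub_le_snd y 0 r)).2
      have h4 := (abs_le.1 (hU.abs_sub_le_initial hv y (y + h))).2
      rw [add_sub_cancel_left] at h4
      rw [sub_zero, abs_of_nonneg hr] at h2
      rw [zero_sub, abs_neg, abs_of_nonneg hr] at h3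
      simp only [Prod.mk_add_mk, add_zero]
      linarith
  have h1 := key x (y - x)
  have h2 := key y (x - y)
  rw [add_sub_cancel] at h1 h2
  rw [abs_sub_comm x y] at h2
  rw [abs_le]
  constructor <;> linarith

theorem IsPotential.ae_hasDerivAt {M L : ℝ} {K : ℝ≥0} {v U : ℝ × ℝ → ℝ}
    (hv : IsPlaneSolution M L v) (hU : IsPotential K v U) :
    ∀ᵐ t, ∀ᵐ x, HasDerivAt (fun y => U (y, t)) (v (x, t)) x := by
  filter_upwards [hU.ae_sub_eq_integral hv] with t ht
  have hi : LocallyIntegrable (fun x => v (x, t)) :=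
    locallyIntegrable_of_abs_le (hv.measurable.comp (by fun_prop)) fun x => hv.abs_le _
  filter_upwards [_root_.LocallyIntegrable.ae_hasDerivAt_integral hi] with x hx
  refine ((hx 0).const_add (U (0, t))).congr_of_eventuallyEq (Eventually.of_forall fun y => ?_)
  have h1 := ht 0 y
  simp only
  linarith

/-! ### Stability of Filippov solutions -/

/-- What the theory of the ordinary differential equation needs from a potential `U` of `u`: it is
Lipschitz, its space derivative is `u`, bounded by `M`, and `u` satisfies Oleĭnik's one-sided
estimate, which is expressed as concavity of `U(·, t) - x² / (2 t)`. -/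
structure IsOleinikPotential (K : ℝ≥0) (M : ℝ) (u : ℝ → ℝ → ℝ) (U : ℝ × ℝ → ℝ) : Prop where
  lipschitz : LipschitzWith K U
  concaveOn : ∀ t, 0 < t → ConcaveOn ℝ univ fun x => U (x, t) - x ^ 2 / (2 * t)
  abs_sub_le : ∀ x y t, 0 ≤ t → |U (y, t) - U (x, t)| ≤ M * |y - x|
  ae_hasDerivAt : ∀ᵐ t ∂(volume.restrict (Ioi 0)), ∀ᵐ x, HasDerivAt (fun y => U (y, t)) (u x t) x

theorem IsEntropySolution.exists_isOleinikPotential {u₀ : ℝ → ℝ} (hu₀ : MemLp u₀ ∞ volume)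
    {u : ℝ → ℝ → ℝ} (hu : IsEntropySolution burgersFlux u₀ u) :
    ∃ K U, IsOleinikPotential K (eLpNorm u₀ ∞ volume).toReal u U := by
  obtain ⟨L, v, hv, huv⟩ := hu.exists_isPlaneSolution hu₀
  obtain ⟨K, U, hU⟩ := hv.exists_isPotential
  refine ⟨K, U, hU.lipschitz, fun t ht => hU.concaveOn hv ht,
    fun x y t ht => hU.abs_sub_le hv x y ht, ?_⟩
  filter_upwards [huv, ae_restrict_of_ae (hU.ae_hasDerivAt hv)] with t h1 h2
  filter_upwards [h1, h2] with x h3 h4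
  rwa [h3]

/-- Secant slopes of a concave function decrease. -/
theorem ConcaveOn.secant_le_secant {f : ℝ → ℝ} (hf : ConcaveOn ℝ univ f) {x y z w : ℝ}
    (hxy : x < y) (hyz : y < z) (hzw : z < w) :
    (f w - f z) / (w - z) ≤ (f y - f x) / (y - x) :=
  (hf.slope_anti_adjacent (mem_univ y) (mem_univ w) hyz hzw).trans
    (hf.slope_anti_adjacent (mem_univ x) (mem_univ z) hxy hyz)

section Envelopes

variable {a : ℝ → ℝ → ℝ} {x t r : ℝ}

theorem upperEnvelope_le {δ : ℝ} (hδ : 0 < δ) (h : ∀ᵐ y, y ∈ Ioo (x - δ) (x + δ) → a y t ≤ r) :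
    upperEnvelope a x t ≤ r := by
  refine (iInf_le _ ⟨δ, hδ⟩).trans (essSup_le_of_ae_le _ ?_)
  refine (ae_restrict_iff' measurableSet_Ioo).2 ?_
  filter_upwards [h] with y hy hyδ
  exact EReal.coe_le_coe_iff.2 (hy hyδ)

theorem le_lowerEnvelope {δ : ℝ} (hδ : 0 < δ) (h : ∀ᵐ y, y ∈ Ioo (x - δ) (x + δ) → r ≤ a y t) :
    r ≤ lowerEnvelope a x t := by
  refine le_trans (le_essInf_of_ae_le _ ?_) (le_iSup (fun δ : {δ : ℝ // 0 < δ} =>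
    essInf (fun y => (a y t : EReal)) (volume.restrict (Ioo (x - δ) (x + δ)))) ⟨δ, hδ⟩)
  refine (ae_restrict_iff' measurableSet_Ioo).2 ?_
  filter_upwards [h] with y hy hyδ
  exact EReal.coe_le_coe_iff.2 (hy hyδ)

theorem le_upperEnvelope (h : ∀ δ > 0, ∀ s < r,
    ∃ᵐ y ∂(volume.restrict (Ioo (x - δ) (x + δ))), s ≤ a y t) : r ≤ upperEnvelope a x t := by
  refine le_iInf fun ⟨δ, hδ⟩ => ?_
  by_contra! hlt
  obtain ⟨s, h1, h2⟩ := EReal.lt_iff_exists_real_btwn.1 hlt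
  refine h δ hδ s (EReal.coe_lt_coe_iff.1 h2) ?_
  filter_upwards [ae_lt_of_essSup_lt h1] with y hy
  exact not_le.2 (EReal.coe_lt_coe_iff.1 hy)

theorem lowerEnvelope_le (h : ∀ δ > 0, ∀ s, r < s →
    ∃ᵐ y ∂(volume.restrict (Ioo (x - δ) (x + δ))), a y t ≤ s) : lowerEnvelope a x t ≤ r := by
  refine iSup_le fun ⟨δ, hδ⟩ => ?_
  by_contra! hlt
  obtain ⟨s, h1, h2⟩ := EReal.lt_iff_exists_real_btwn.1 hlt
  refine h δ hδ s (EReal.coe_lt_coe_iff.1 h1) ?_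
  filter_upwards [ae_lt_of_lt_essInf h2] with y hy
  exact not_le.2 (EReal.coe_lt_coe_iff.1 hy)

end Envelopes

section Velocity

variable {K : ℝ≥0} {M : ℝ} {u : ℝ → ℝ → ℝ} {U : ℝ × ℝ → ℝ} {t : ℝ}

theorem IsOleinikPotential.bound_nonneg (hU : IsOleinikPotential K M u U) : 0 ≤ M := by
  simpa using (abs_nonneg _).trans (hU.abs_sub_le 0 1 0 le_rfl)

theorem IsOleinikPotential.abs_le_of_hasDerivAt (hU : IsOleinikPotential K M u U) (ht : 0 ≤ t)
    {x p : ℝ} (h : HasDerivAt (fun y => U (y, t)) p x) : |p| ≤ M :=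
  h.le_of_lip' hU.bound_nonneg (Eventually.of_forall fun y => hU.abs_sub_le x y t ht)

theorem hasDerivAt_sub_sq_div {f : ℝ → ℝ} {x p : ℝ} (h : HasDerivAt f p x) (t : ℝ) :
    HasDerivAt (fun y => f y - y ^ 2 / (2 * t)) (p - x / t) x := by
  have h2 : HasDerivAt (fun y : ℝ => y ^ 2 / (2 * t)) (2 * x / (2 * t)) x := by
    simpa using (hasDerivAt_pow 2 x).div_const (2 * t)
  rw [mul_div_mul_left _ _ two_ne_zero] at h2
  exact h.sub h2

theorem IsOleinikPotential.sub_le_of_hasDerivAt (hU : IsOleinikPotential K M u U) (ht : 0 < t)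
    {x y p q : ℝ} (hxy : x < y) (hp : HasDerivAt (fun y => U (y, t)) p x)
    (hq : HasDerivAt (fun y => U (y, t)) q y) : q - p ≤ (y - x) / t := by
  have h1 := (hU.concaveOn t ht).le_slope_of_hasDerivAt (mem_univ x) (mem_univ y) hxy
    (hasDerivAt_sub_sq_div hq t)
  have h2 := (hU.concaveOn t ht).slope_le_of_hasDerivAt (mem_univ x) (mem_univ y) hxy
    (hasDerivAt_sub_sq_div hp t)
  rw [sub_div]
  linarith

theorem IsOleinikPotential.upperEnvelope_le (hU : IsOleinikPotential K M u U) (c : ℝ) (ht : 0 ≤ t)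
    (h : ∀ᵐ x, HasDerivAt (fun y => U (y, t)) (u x t) x) (x : ℝ) :
    upperEnvelope (particleVelocity burgersFlux u c) x t ≤ ((M + c) / 2 : ℝ) := by
  refine _root_.upperEnvelope_le one_pos ?_
  filter_upwards [h] with y hy _
  rw [particleVelocity_burgersFlux]
  linarith [(abs_le.1 (hU.abs_le_of_hasDerivAt ht hy)).2]

theorem IsOleinikPotential.le_lowerEnvelope (hU : IsOleinikPotential K M u U) (c : ℝ) (ht : 0 ≤ t)
    (h : ∀ᵐ x, HasDerivAt (fun y => U (y, t)) (u x t) x) (x : ℝ) :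
    ((-M + c) / 2 : ℝ) ≤ lowerEnvelope (particleVelocity burgersFlux u c) x t := by
  refine _root_.le_lowerEnvelope one_pos ?_
  filter_upwards [h] with y hy _
  rw [particleVelocity_burgersFlux]
  linarith [(abs_le.1 (hU.abs_le_of_hasDerivAt ht hy)).1]

/-- The Filippov velocity inherits the one-sided Lipschitz estimate, with constant `1 / (2 t)`. -/
theorem IsOleinikPotential.velocity_sub_le (hU : IsOleinikPotential K M u U) {c : ℝ} (ht : 0 < t)
    (h : ∀ᵐ x, HasDerivAt (fun y => U (y, t)) (u x t) x) {x y r r' : ℝ} (hxy : x < y)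
    (hr : r ≤ upperEnvelope (particleVelocity burgersFlux u c) y t)
    (hr' : lowerEnvelope (particleVelocity burgersFlux u c) x t ≤ r') :
    r - r' ≤ (y - x) / (2 * t) := by
  have key : ∀ δ > 0, δ < (y - x) / 2 → r - (y - x + 2 * δ) / (2 * t) ≤ r' := by
    intro δ hδ hδ'
    rw [← EReal.coe_le_coe_iff]
    refine le_trans (_root_.le_lowerEnvelope hδ ?_) hr'
    filter_upwards [h] with z hz hzδ
    rw [sub_le_iff_le_add, ← EReal.coe_le_coe_iff]
    refine hr.trans (_root_.upperEnvelope_le hδ ?_)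
    filter_upwards [h] with w hw hwδ
    have h1 := hU.sub_le_of_hasDerivAt ht (by linarith [hzδ.2, hwδ.1] : z < w) hz hw
    have h2 : (w - z) / t ≤ (y - x + 2 * δ) / t := by
      gcongr
      linarith [hzδ.1, hwδ.2]
    have h3 : (y - x + 2 * δ) / (2 * t) = (y - x + 2 * δ) / t / 2 := by
      rw [div_div, mul_comm 2 t]
    rw [particleVelocity_burgersFlux, particleVelocity_burgersFlux, h3]
    linarith
  have hlim : Tendsto (fun δ : ℝ => r - (y - x + 2 * δ) / (2 * t)) (𝓝[>] 0)
      (𝓝 (r - (y - x + 2 * 0) / (2 * t))) :=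
    ((by fun_prop : Continuous fun δ : ℝ => r - (y - x + 2 * δ) / (2 * t)).tendsto 0).mono_left
      nhdsWithin_le_nhds
  have := le_of_tendsto hlim (by
    filter_upwards [Ioo_mem_nhdsGT (by linarith : (0 : ℝ) < (y - x) / 2)] with δ hδ
    exact key δ hδ.1 hδ.2)
  rw [mul_zero, add_zero] at this
  linarith

end Velocity

theorem AbsolutelyContinuousOnInterval.sub_le_of_ae_deriv_le {g : ℝ → ℝ} {s T B : ℝ} (hsT : s ≤ T)
    (hg : AbsolutelyContinuousOnInterval g s T)
    (h : ∀ᵐ t ∂(volume.restrict (Ioc s T)), deriv g t ≤ B) : g T - g s ≤ B * (T - s) := by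
  rw [← hg.integral_deriv_eq_sub]
  refine (intervalIntegral.integral_mono_ae_restrict hsT hg.intervalIntegrable_deriv
    (g := fun _ => B) intervalIntegrable_const ?_).trans (le_of_eq ?_)
  · rw [Measure.restrict_congr_set Ioc_ae_eq_Icc.symm]
    exact h
  · simp [mul_comm]

section Stability

variable {K : ℝ≥0} {M : ℝ} {u : ℝ → ℝ → ℝ} {U : ℝ × ℝ → ℝ} {c s x y : ℝ} {ξ ζ : ℝ → ℝ}

theorem IsFilippovSolution.mono {a : ℝ → ℝ → ℝ} (hξ : IsFilippovSolution a s x ξ) {σ : ℝ}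
    (hσ : s ≤ σ) : IsFilippovSolution a σ (ξ σ) ξ where
  initial := rfl
  absolutelyContinuous T hT := (hξ.absolutelyContinuous T (hσ.trans hT)).mono (by
    rw [uIcc_of_le hT, uIcc_of_le (hσ.trans hT)]
    exact Icc_subset_Icc_left hσ)
  inclusion := ae_restrict_of_ae_restrict_of_subset (Ioi_subset_Ioi hσ) hξ.inclusion

theorem IsOleinikPotential.ae_deriv_bounds (hU : IsOleinikPotential K M u U) (hs : 0 ≤ s)
    (hξ : IsFilippovSolution (particleVelocity burgersFlux u c) s x ξ) :
    ∀ᵐ t ∂(volume.restrict (Ioi s)), (-M + c) / 2 ≤ deriv ξ t ∧ deriv ξ t ≤ (M + c) / 2 := by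
  filter_upwards [hξ.inclusion, ae_restrict_of_ae_restrict_of_subset (Ioi_subset_Ioi hs)
    hU.ae_hasDerivAt, ae_restrict_mem measurableSet_Ioi] with t ⟨_, h1, h2⟩ h3 h4
  have ht : 0 ≤ t := hs.trans (mem_Ioi.1 h4).le
  exact ⟨EReal.coe_le_coe_iff.1 ((hU.le_lowerEnvelope c ht h3 _).trans h1),
    EReal.coe_le_coe_iff.1 (h2.trans (hU.upperEnvelope_le c ht h3 _))⟩

theorem IsOleinikPotential.abs_sub_le_of_isFilippovSolution (hU : IsOleinikPotential K M u U)
    (hs : 0 ≤ s) (hξ : IsFilippovSolution (particleVelocity burgersFlux u c) s x ξ) {t t' : ℝ}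
    (ht : s ≤ t) (htt' : t ≤ t') : |ξ t' - ξ t| ≤ (M + |c|) / 2 * (t' - t) := by
  have hac := (hξ.mono ht).absolutelyContinuous t' htt'
  have hb := ae_restrict_of_ae_restrict_of_subset (Ioc_subset_Ioi_self : Ioc t t' ⊆ Ioi t)
    (hU.ae_deriv_bounds (hs.trans ht) (hξ.mono ht))
  have hc := neg_abs_le c
  have hc' := le_abs_self c
  have h1 := hac.sub_le_of_ae_deriv_le htt' (B := (M + |c|) / 2) (by
    filter_upwards [hb] with r hr
    linarith [hr.2])
  have h2 := hac.neg.sub_le_of_ae_deriv_le htt' (B := (M + |c|) / 2) (by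
    filter_upwards [hb] with r hr
    rw [deriv.neg]
    linarith [hr.1])
  simp only [Pi.neg_apply] at h2
  rw [abs_le]
  constructor <;> linarith

theorem IsOleinikPotential.ae_deriv_sub (hU : IsOleinikPotential K M u U) (hs : 0 ≤ s)
    (hξ : IsFilippovSolution (particleVelocity burgersFlux u c) s x ξ)
    (hζ : IsFilippovSolution (particleVelocity burgersFlux u c) s y ζ) :
    ∀ᵐ t ∂(volume.restrict (Ioi s)), HasDerivAt (fun t => ζ t - ξ t) (deriv ζ t - deriv ξ t) t ∧
      |deriv ζ t - deriv ξ t| ≤ M ∧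
      2 * t * ((ζ t - ξ t) * (deriv ζ t - deriv ξ t)) ≤ (ζ t - ξ t) ^ 2 := by
  filter_upwards [hξ.inclusion, hζ.inclusion, hU.ae_deriv_bounds hs hξ, hU.ae_deriv_bounds hs hζ,
    ae_restrict_of_ae_restrict_of_subset (Ioi_subset_Ioi hs) hU.ae_hasDerivAt,
    ae_restrict_mem measurableSet_Ioi] with t ⟨h1, h2, h3⟩ ⟨h4, h5, h6⟩ h7 h8 h9 h10
  have ht : 0 < t := hs.trans_lt h10
  refine ⟨h4.hasDerivAt.sub h1.hasDerivAt, ?_, ?_⟩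
  · rw [abs_le]
    constructor <;> linarith [h7.1, h7.2, h8.1, h8.2]
  · rcases lt_trichotomy (ξ t) (ζ t) with h | h | h
    · have h11 := hU.velocity_sub_le ht h9 h h6 h2
      rw [le_div_iff₀ (by positivity)] at h11
      nlinarith
    · simp [h]
    · have h11 := hU.velocity_sub_le ht h9 h h3 h5
      rw [le_div_iff₀ (by positivity)] at h11
      nlinarith

theorem IsOleinikPotential.abs_sub_le_add (hU : IsOleinikPotential K M u U) (hs : 0 ≤ s)
    (hξ : IsFilippovSolution (particleVelocity burgersFlux u c) s x ξ)
    (hζ : IsFilippovSolution (particleVelocity burgersFlux u c) s y ζ) {t : ℝ} (ht : s ≤ t) :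
    |ζ t - ξ t| ≤ |y - x| + M * (t - s) := by
  have hac := (hζ.absolutelyContinuous t ht).sub (hξ.absolutelyContinuous t ht)
  have hb := ae_restrict_of_ae_restrict_of_subset (Ioc_subset_Ioi_self : Ioc s t ⊆ Ioi s)
    (hU.ae_deriv_sub hs hξ hζ)
  have h1 := hac.sub_le_of_ae_deriv_le ht (B := M) (by
    filter_upwards [hb] with r hr
    exact hr.1.deriv.trans_le (abs_le.1 hr.2.1).2)
  have h2 := hac.neg.sub_le_of_ae_deriv_le ht (B := M) (by
    filter_upwards [hb] with r hr
    have : deriv (-(ζ - ξ)) r = -(deriv ζ r - deriv ξ r) := hr.1.neg.deriv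
    rw [this]
    linarith [(abs_le.1 hr.2.1).1])
  simp only [Pi.neg_apply, Pi.sub_apply, hξ.initial, hζ.initial] at h1 h2
  rw [abs_le]
  constructor <;> linarith [neg_abs_le (y - x), le_abs_self (y - x)]

/-- `(ζ - ξ)² / t` does not increase along two Filippov solutions. -/
theorem IsOleinikPotential.sq_sub_mul_le (hU : IsOleinikPotential K M u U) (hs : 0 < s)
    (hξ : IsFilippovSolution (particleVelocity burgersFlux u c) s x ξ)
    (hζ : IsFilippovSolution (particleVelocity burgersFlux u c) s y ζ) {t : ℝ} (ht : s ≤ t) :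
    (ζ t - ξ t) ^ 2 * s ≤ (y - x) ^ 2 * t := by
  have hac := (hζ.absolutelyContinuous t ht).sub (hξ.absolutelyContinuous t ht)
  have hinv : AbsolutelyContinuousOnInterval (fun r : ℝ => r⁻¹) s t := by
    refine ContDiffOn.absolutelyContinuousOnInterval (ContDiffOn.inv contDiffOn_id fun r hr => ?_)
    rw [uIcc_of_le ht] at hr
    exact (hs.trans_le hr.1).ne'
  have hg := (hac.mul hac).mul hinv
  have hb := ae_restrict_of_ae_restrict_of_subset (Ioc_subset_Ioi_self : Ioc s t ⊆ Ioi s)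
    (hU.ae_deriv_sub hs.le hξ hζ)
  have h1 := hg.sub_le_of_ae_deriv_le ht (B := 0) (by
    filter_upwards [hb, ae_restrict_mem measurableSet_Ioc] with r ⟨h2, _, h3⟩ h4
    have hr : 0 < r := hs.trans h4.1
    have h5 := (h2.mul h2).mul (hasDerivAt_inv hr.ne')
    refine h5.deriv.trans_le ?_
    simp only [Pi.mul_apply]
    have h6 : ((deriv ζ r - deriv ξ r) * (ζ r - ξ r) + (ζ r - ξ r) * (deriv ζ r - deriv ξ r)) * r⁻¹
        + (ζ r - ξ r) * (ζ r - ξ r) * -(r ^ 2)⁻¹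
        = (2 * r * ((ζ r - ξ r) * (deriv ζ r - deriv ξ r)) - (ζ r - ξ r) ^ 2) / r ^ 2 := by
      field_simp
      ring
    rw [h6]
    exact div_nonpos_of_nonpos_of_nonneg (by linarith) (by positivity))
  simp only [Pi.mul_apply, Pi.sub_apply, hξ.initial, hζ.initial] at h1
  have ht0 : 0 < t := hs.trans_le ht
  have h2 : (ζ t - ξ t) ^ 2 / t ≤ (y - x) ^ 2 / s := by
    rw [div_eq_mul_inv, div_eq_mul_inv]
    linarith
  rwa [div_le_div_iff₀ ht0 hs] at h2

/-- Stability: the linear bound `D(ρ) ≤ D(s) + M (ρ - s)` is used up to the time `ρ = D(s) / M`, and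
the bound `D(t)² / t ≤ D(ρ)² / ρ` afterwards. -/
theorem IsOleinikPotential.stability (hU : IsOleinikPotential K M u U) (hs : 0 ≤ s)
    (hξ : IsFilippovSolution (particleVelocity burgersFlux u c) s x ξ)
    (hζ : IsFilippovSolution (particleVelocity burgersFlux u c) s y ζ) {t : ℝ} (ht : s ≤ t) :
    |ζ t - ξ t| ≤ |y - x| + 2 * √(M * |y - x| * t) := by
  have hM := hU.bound_nonneg
  have ht0 : 0 ≤ t := hs.trans ht
  -- `d` exceeds `|y - x|` so that the time `d / M` is positive even if `x = y`.
  have key : ∀ d, |y - x| < d → |ζ t - ξ t| ≤ d + 2 * √(M * d * t) := by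
    intro d hd
    have hd0 : 0 < d := (abs_nonneg _).trans_lt hd
    have hlin : ∀ r, s ≤ r → |ζ r - ξ r| ≤ d + M * (r - s) := fun r hr =>
      (hU.abs_sub_le_add hs hξ hζ hr).trans (by linarith)
    rcases le_or_gt (M * t) d with h | h
    · have h1 : M * t ≤ √(M * d * t) := by
        refine Real.le_sqrt_of_sq_le ?_
        have := mul_le_mul_of_nonneg_right h (mul_nonneg hM ht0)
        linarith
      have h2 := hlin t ht
      have h3 : 0 ≤ M * s := mul_nonneg hM hs
      have h4 := Real.sqrt_nonneg (M * d * t)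
      linarith
    · have hM0 : 0 < M := by
        by_contra! h0
        have : M = 0 := le_antisymm h0 hM
        rw [this, zero_mul] at h
        linarith
      set ρ := max s (d / M) with hρ
      have hρ0 : 0 < ρ := lt_max_of_lt_right (by positivity)
      have hρs : s ≤ ρ := le_max_left _ _
      have hρt : ρ ≤ t := max_le ht (by rw [div_le_iff₀ hM0]; linarith)
      have h1 : |ζ ρ - ξ ρ| ≤ 2 * d := by
        refine (hlin ρ hρs).trans ?_
        have : M * (ρ - s) ≤ d := by
          rcases max_choice s (d / M) with h2 | h2
          · rw [hρ, h2, sub_self, mul_zero]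
            exact hd0.le
          · rw [hρ, h2, mul_sub, mul_div_cancel₀ _ hM0.ne']
            linarith [mul_nonneg hM hs]
        linarith
      have h2 := hU.sq_sub_mul_le hρ0 (hξ.mono hρs) (hζ.mono hρs) hρt
      have h3 : (ζ ρ - ξ ρ) ^ 2 ≤ (2 * d) ^ 2 := sq_le_sq' (abs_le.1 h1).1 (abs_le.1 h1).2
      have h4 : (ζ t - ξ t) ^ 2 * (d / M) ≤ (2 * d) ^ 2 * t :=
        (mul_le_mul_of_nonneg_left (le_max_right _ _) (sq_nonneg _)).trans
          (h2.trans (mul_le_mul_of_nonneg_right h3 ht0))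
      have h5 : (ζ t - ξ t) ^ 2 ≤ 4 * (M * d * t) := by
        rw [mul_div_assoc', div_le_iff₀ hM0] at h4
        refine le_of_mul_le_mul_right (a := d) ?_ hd0
        linarith
      have h6 : |ζ t - ξ t| ≤ 2 * √(M * d * t) := by
        refine abs_le_of_sq_le_sq ?_ (by positivity)
        rw [mul_pow, Real.sq_sqrt (by positivity)]
        linarith
      linarith
  have hlim : Tendsto (fun d : ℝ => d + 2 * √(M * d * t)) (𝓝[>] |y - x|)
      (𝓝 (|y - x| + 2 * √(M * |y - x| * t))) :=
    ((by fun_prop : Continuous fun d : ℝ => d + 2 * √(M * d * t)).tendsto _).mono_left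
      nhdsWithin_le_nhds
  exact ge_of_tendsto hlim (by
    filter_upwards [self_mem_nhdsWithin] with d hd
    exact key d hd)

end Stability

/-! ### Existence of Filippov solutions and the flow -/

/-- The velocity `(u + c) / 2` with `u = ∂ₓU` replaced by a central difference quotient. -/
noncomputable def differenceVelocity (U : ℝ × ℝ → ℝ) (c h t x : ℝ) : ℝ :=
  ((U (x + h, t) - U (x - h, t)) / (2 * h) + c) / 2

section DifferenceVelocity

variable {K : ℝ≥0} {U : ℝ × ℝ → ℝ} {c h : ℝ}

theorem abs_differenceVelocity_le (hU : LipschitzWith K U) (hh : 0 < h) (t x : ℝ) :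
    |differenceVelocity U c h t x| ≤ (K + |c|) / 2 := by
  have h1 := hU.abs_sub_le_fst (x + h) (x - h) t
  rw [show x + h - (x - h) = 2 * h by ring, abs_of_pos (by positivity : 0 < 2 * h)] at h1
  have h2 : |(U (x + h, t) - U (x - h, t)) / (2 * h)| ≤ K := by
    rw [abs_div, abs_of_pos (by positivity : 0 < 2 * h), div_le_iff₀ (by positivity)]
    exact h1
  rw [differenceVelocity, abs_div, abs_two]
  gcongr
  exact (abs_add_le _ _).trans (by linarith)

theorem lipschitzWith_differenceVelocity (hU : LipschitzWith K U) (hh : 0 < h) (t : ℝ) :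
    LipschitzWith (K / h / 2).toNNReal (differenceVelocity U c h t) := by
  refine LipschitzWith.of_dist_le_mul fun x y => ?_
  rw [Real.coe_toNNReal _ (by positivity), Real.dist_eq, Real.dist_eq]
  have h1 := hU.abs_sub_le_fst (x + h) (y + h) t
  have h2 := hU.abs_sub_le_fst (x - h) (y - h) t
  rw [add_sub_add_right_eq_sub] at h1
  rw [sub_sub_sub_cancel_right] at h2
  have h3 : differenceVelocity U c h t x - differenceVelocity U c h t y
      = ((U (x + h, t) - U (y + h, t)) - (U (x - h, t) - U (y - h, t))) / (4 * h) := by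
    unfold differenceVelocity
    field_simp
    ring
  rw [h3, abs_div, abs_of_pos (by positivity : 0 < 4 * h), div_le_iff₀ (by positivity)]
  refine (abs_sub _ _).trans ((add_le_add h1 h2).trans (le_of_eq ?_))
  field_simp
  ring

theorem exists_solution_differenceVelocity (hU : LipschitzWith K U) (hh : 0 < h) (s x T : ℝ)
    (hT : 0 ≤ T) :
    ∃ β : ℝ → ℝ, β s = x ∧ LipschitzWith ((K + |c|) / 2).toNNReal β ∧
      ∀ t ∈ Ioo s (s + T), HasDerivAt β (differenceVelocity U c h t (β t)) t := by
  set Λ : ℝ≥0 := ((K + |c|) / 2).toNNReal with hΛ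
  have hΛ' : (Λ : ℝ) = (K + |c|) / 2 := Real.coe_toNNReal _ (by positivity)
  have hsT : s ≤ s + T := by linarith
  have hpl : IsPicardLindelof (differenceVelocity U c h) (tmin := s) (tmax := s + T)
      ⟨s, left_mem_Icc.2 hsT⟩ x (Λ * T.toNNReal) 0 Λ (K / h / 2).toNNReal := by
    refine ⟨fun t _ => (lipschitzWith_differenceVelocity hU hh t).lipschitzOnWith, fun y _ => ?_,
      fun t _ y _ => ?_, ?_⟩
    · have := hU.continuous
      unfold differenceVelocity
      fun_prop
    · rw [hΛ', Real.norm_eq_abs]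
      exact abs_differenceVelocity_le hU hh t y
    · simp [Real.coe_toNNReal _ hT, hT]
  obtain ⟨α, hα0, hα⟩ := hpl.exists_eq_forall_mem_Icc_hasDerivWithinAt₀
  have hαL : LipschitzOnWith Λ α (Icc s (s + T)) := by
    refine (convex_Icc _ _).lipschitzOnWith_of_nnnorm_hasDerivWithin_le hα fun t _ => ?_
    rw [← NNReal.coe_le_coe, hΛ', coe_nnnorm, Real.norm_eq_abs]
    exact abs_differenceVelocity_le hU hh _ _
  refine ⟨fun t => α (projIcc s (s + T) hsT t), ?_, ?_, fun t ht => ?_⟩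
  · simp only [projIcc_left]
    exact hα0
  · have h1 := (lipschitzOnWith_iff_restrict.1 hαL).comp (LipschitzWith.projIcc hsT)
    rw [mul_one] at h1
    exact h1
  · have h1 : (fun t => α (projIcc s (s + T) hsT t)) =ᶠ[𝓝 t] α := by
      filter_upwards [Icc_mem_nhds ht.1 ht.2] with r hr
      rw [projIcc_of_mem hsT hr]
    have h2 := (hα t ⟨ht.1.le, ht.2.le⟩).hasDerivAt (Icc_mem_nhds ht.1 ht.2)
    simp only [projIcc_of_mem hsT ⟨ht.1.le, ht.2.le⟩]
    exact h2.congr_of_eventuallyEq h1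

/-- A one-sided bound for the velocity of a limit of solutions with difference quotients. All secant
slopes of the concave function `U(·, τ) - x² / (2 τ)` to the right of `[y, z]` are at most the
slope on `[y, z]`, and the latter is continuous in `τ`. -/
theorem two_mul_deriv_sub_le_secant (hU : LipschitzWith K U)
    (hconc : ∀ t, 0 < t → ConcaveOn ℝ univ fun x => U (x, t) - x ^ 2 / (2 * t)) {l : Filter ℕ}
    [l.NeBot] {h : ℕ → ℝ} (hh : ∀ n, 0 < h n) (hlim : Tendsto h l (𝓝 0)) {β : ℕ → ℝ → ℝ} {Λ : ℝ≥0}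
    (hβL : ∀ n, LipschitzWith Λ (β n)) {ξ : ℝ → ℝ} (hβ : ∀ t, Tendsto (fun n => β n t) l (𝓝 (ξ t)))
    {t T r y z : ℝ} (ht : 0 < t) (htT : t < T)
    (hode : ∀ᶠ n in l, ∀ τ ∈ Ico t T, HasDerivAt (β n) (differenceVelocity U c (h n) τ (β n τ)) τ)
    (hr : HasDerivAt ξ r t) (hyz : y < z) (hz : z < ξ t) :
    2 * r - c ≤ (U (z, t) - U (y, t)) / (z - y) + (2 * ξ t - y - z) / (2 * t) := by
  refine le_of_forall_pos_le_add fun e he => ?_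
  let Θ : ℝ × ℝ → ℝ := fun p =>
    (U (z, p.1) - U (y, p.1)) / (z - y) + (2 * p.2 - y - z) / (2 * p.1)
  have hΘ : ContinuousAt Θ (t, ξ t) := by
    have := hU.continuous
    refine ContinuousAt.add (Continuous.continuousAt (by fun_prop)) (ContinuousAt.div
      (Continuous.continuousAt (by fun_prop)) (Continuous.continuousAt (by fun_prop)) ?_)
    positivity
  have hev : ∀ᶠ p in 𝓝 (t, ξ t), Θ p < Θ (t, ξ t) + e ∧ 0 < p.1 ∧ (z + ξ t) / 2 < p.2 ∧ p.1 < T :=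
    (hΘ.eventually_lt continuousAt_const (by linarith)).and
      ((continuousAt_const.eventually_lt continuousAt_fst ht).and
        ((continuousAt_const.eventually_lt continuousAt_snd (by simp only; linarith)).and
          (continuousAt_fst.eventually_lt continuousAt_const htT)))
  obtain ⟨ρ, hρ0, hρ⟩ := Metric.eventually_nhds_iff.1 hev
  set k₀ := ρ / (2 * (Λ + 1)) with hk₀
  have hk₀0 : 0 < k₀ := by positivity
  have hk₀ρ : k₀ < ρ ∧ Λ * k₀ ≤ ρ / 2 := by
    rw [hk₀]
    constructor
    · rw [div_lt_iff₀ (by positivity)]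
      nlinarith [Λ.2]
    · rw [mul_div_assoc', div_le_div_iff₀ (by positivity) (by positivity)]
      nlinarith [Λ.2]
  -- the increments of the approximate solutions
  have hinc : ∀ᶠ n in l, ∀ k ∈ Ioo 0 k₀,
      β n (t + k) - β n t ≤ (Θ (t, ξ t) + e + c) / 2 * (t + k - t) := by
    filter_upwards [hode, hlim.eventually_lt_const (by linarith : (0 : ℝ) < (ξ t - z) / 2),
      Metric.tendsto_nhds.1 (hβ t) (ρ / 2) (by positivity)] with n h1 h2 h3 k hk
    have hmem : ∀ τ ∈ Icc t (t + k), Θ (τ, β n τ) < Θ (t, ξ t) + e ∧ 0 < τ ∧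
        (z + ξ t) / 2 < β n τ ∧ τ < T := by
      intro τ hτ
      have hτk : dist τ t ≤ k := by
        rw [Real.dist_eq, abs_of_nonneg (by linarith [hτ.1])]
        linarith [hτ.2]
      refine hρ (y := (τ, β n τ)) ?_
      rw [Prod.dist_eq, max_lt_iff]
      refine ⟨hτk.trans_lt (hk.2.trans hk₀ρ.1), ?_⟩
      have h4 := (hβL n).dist_le_mul τ t
      have h5 : Λ * dist τ t ≤ Λ * k₀ := by
        gcongr
        exact hτk.trans hk.2.le
      linarith [dist_triangle (β n τ) (β n t) (ξ t), hk₀ρ.2]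
    have hd : ∀ τ ∈ Icc t (t + k), HasDerivAt (β n)
        (differenceVelocity U c (h n) τ (β n τ)) τ := fun τ hτ => h1 τ ⟨hτ.1, (hmem τ hτ).2.2.2⟩
    refine (convex_Icc t (t + k)).image_sub_le_mul_sub_of_deriv_le
      (fun τ hτ => (hd τ hτ).continuousAt.continuousWithinAt)
      (fun τ hτ => (hd τ (interior_subset hτ)).differentiableAt.differentiableWithinAt)
      (fun τ hτ => ?_) t (left_mem_Icc.2 (by linarith [hk.1])) (t + k)
      (right_mem_Icc.2 (by linarith [hk.1])) (by linarith [hk.1])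
    obtain ⟨h4, h5, h6, -⟩ := hmem τ (interior_subset hτ)
    rw [(hd τ (interior_subset hτ)).deriv]
    have h7 := (hconc τ h5).secant_le_secant hyz (by linarith : z < β n τ - h n)
      (by linarith [hh n] : β n τ - h n < β n τ + h n)
    have h8 : ((U (β n τ + h n, τ) - (β n τ + h n) ^ 2 / (2 * τ))
        - (U (β n τ - h n, τ) - (β n τ - h n) ^ 2 / (2 * τ))) / (β n τ + h n - (β n τ - h n))
        = (U (β n τ + h n, τ) - U (β n τ - h n, τ)) / (2 * h n) - β n τ / τ := by
      have := (hh n).ne'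
      have h9 : β n τ + h n - (β n τ - h n) = 2 * h n := by ring
      rw [h9]
      field_simp
      ring
    have h10 : ((U (z, τ) - z ^ 2 / (2 * τ)) - (U (y, τ) - y ^ 2 / (2 * τ))) / (z - y)
        = (U (z, τ) - U (y, τ)) / (z - y) - (y + z) / (2 * τ) := by
      have : z - y ≠ 0 := by linarith
      field_simp
      ring
    rw [h8, h10] at h7
    have h11 : Θ (τ, β n τ) = (U (z, τ) - U (y, τ)) / (z - y) + β n τ / τ
        - (y + z) / (2 * τ) := by
      simp only [Θ]
      field_simp
      ring
    unfold differenceVelocity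
    linarith
  have hlim_inc : ∀ k ∈ Ioo 0 k₀, ξ (t + k) - ξ t ≤ (Θ (t, ξ t) + e + c) / 2 * (t + k - t) :=
    fun k hk => le_of_tendsto ((hβ (t + k)).sub (hβ t)) (by
      filter_upwards [hinc] with n hn
      exact hn k hk)
  have hder : r ≤ (Θ (t, ξ t) + e + c) / 2 := by
    have h1 := hr.tendsto_slope_zero_right
    refine le_of_tendsto h1 ?_
    filter_upwards [Ioo_mem_nhdsGT hk₀0] with k hk
    rw [smul_eq_mul, inv_mul_le_iff₀ hk.1]
    linarith [hlim_inc k hk]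
  change 2 * r - c ≤ Θ (t, ξ t) + e
  linarith

theorem two_mul_deriv_sub_le (hU : LipschitzWith K U)
    (hconc : ∀ t, 0 < t → ConcaveOn ℝ univ fun x => U (x, t) - x ^ 2 / (2 * t)) {l : Filter ℕ}
    [l.NeBot] {h : ℕ → ℝ} (hh : ∀ n, 0 < h n) (hlim : Tendsto h l (𝓝 0)) {β : ℕ → ℝ → ℝ} {Λ : ℝ≥0}
    (hβL : ∀ n, LipschitzWith Λ (β n)) {ξ : ℝ → ℝ} (hβ : ∀ t, Tendsto (fun n => β n t) l (𝓝 (ξ t)))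
    {t T r y p : ℝ} (ht : 0 < t) (htT : t < T)
    (hode : ∀ᶠ n in l, ∀ τ ∈ Ico t T, HasDerivAt (β n) (differenceVelocity U c (h n) τ (β n τ)) τ)
    (hr : HasDerivAt ξ r t) (hy : y < ξ t) (hp : HasDerivAt (fun x => U (x, t)) p y) :
    2 * r - c ≤ p + (ξ t - y) / t := by
  have h1 : Tendsto (fun z => (U (z, t) - U (y, t)) / (z - y)) (𝓝[>] y) (𝓝 p) := by
    have := (hasDerivAt_iff_tendsto_slope.1 hp).mono_left
      (nhdsWithin_mono y fun z (hz : y < z) => hz.ne')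
    refine this.congr fun z => ?_
    rw [slope_def_field]
  have h2 : Tendsto (fun z => (2 * ξ t - y - z) / (2 * t)) (𝓝[>] y)
      (𝓝 ((2 * ξ t - y - y) / (2 * t))) :=
    ((by fun_prop : Continuous fun z : ℝ => (2 * ξ t - y - z) / (2 * t)).tendsto y).mono_left
      nhdsWithin_le_nhds
  have h3 : (2 * ξ t - y - y) / (2 * t) = (ξ t - y) / t := by
    rw [show 2 * ξ t - y - y = 2 * (ξ t - y) by ring, mul_div_mul_left _ _ two_ne_zero]
  rw [h3] at h2
  refine ge_of_tendsto (h1.add h2) ?_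
  filter_upwards [Ioo_mem_nhdsGT hy] with z hz
  exact two_mul_deriv_sub_le_secant hU hconc hh hlim hβL hβ ht htT hode hr hz.1 hz.2

/-- The bound from below, by the reflection `x ↦ -x`, `u ↦ -u`. -/
theorem le_two_mul_deriv_sub (hU : LipschitzWith K U)
    (hconc : ∀ t, 0 < t → ConcaveOn ℝ univ fun x => U (x, t) - x ^ 2 / (2 * t)) {l : Filter ℕ}
    [l.NeBot] {h : ℕ → ℝ} (hh : ∀ n, 0 < h n) (hlim : Tendsto h l (𝓝 0)) {β : ℕ → ℝ → ℝ} {Λ : ℝ≥0}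
    (hβL : ∀ n, LipschitzWith Λ (β n)) {ξ : ℝ → ℝ} (hβ : ∀ t, Tendsto (fun n => β n t) l (𝓝 (ξ t)))
    {t T r y p : ℝ} (ht : 0 < t) (htT : t < T)
    (hode : ∀ᶠ n in l, ∀ τ ∈ Ico t T, HasDerivAt (β n) (differenceVelocity U c (h n) τ (β n τ)) τ)
    (hr : HasDerivAt ξ r t) (hy : ξ t < y) (hp : HasDerivAt (fun x => U (x, t)) p y) :
    p - (y - ξ t) / t ≤ 2 * r - c := by
  have hU' : LipschitzWith K fun P : ℝ × ℝ => U (-P.1, P.2) := by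
    refine LipschitzWith.of_dist_le_mul fun P Q => (hU.dist_le_mul _ _).trans (le_of_eq ?_)
    rw [Prod.dist_eq, Prod.dist_eq, dist_neg_neg]
  have hconc' : ∀ t, 0 < t → ConcaveOn ℝ univ fun x => U (-x, t) - x ^ 2 / (2 * t) := by
    intro t ht
    have h1 := (hconc t ht).comp_linearMap (-LinearMap.id : ℝ →ₗ[ℝ] ℝ)
    rw [preimage_univ] at h1
    exact h1.congr fun x _ => by simp
  have hp' : HasDerivAt (fun x => U (-x, t)) (-p) (-y) := by
    have h1 : HasDerivAt (fun x => U (x, t)) p (-(-y)) := by rwa [neg_neg]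
    have h2 := HasDerivAt.comp (h := fun x : ℝ => -x) (-y) h1 (hasDerivAt_neg (-y))
    rw [mul_neg_one] at h2
    exact h2
  have h1 := two_mul_deriv_sub_le (c := -c) (β := fun n t => -β n t) (ξ := fun t => -ξ t) (r := -r)
    hU' hconc' hh hlim (fun n => (hβL n).neg) (fun t => (hβ t).neg) ht htT (by
      filter_upwards [hode] with n hn τ hτ
      have h2 := (hn τ hτ).neg
      have h3 : differenceVelocity (fun P : ℝ × ℝ => U (-P.1, P.2)) (-c) (h n) τ (-β n τ)
          = -differenceVelocity U c (h n) τ (β n τ) := by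
        unfold differenceVelocity
        have h4 : -(-β n τ + h n) = β n τ - h n := by ring
        have h5 : -(-β n τ - h n) = β n τ + h n := by ring
        simp only [h4, h5]
        ring
      rw [h3]
      exact h2) hr.neg (neg_lt_neg hy) hp'
  have h6 : (-ξ t - -y) / t = (y - ξ t) / t := by ring
  rw [h6] at h1
  linarith

end DifferenceVelocity

section WellPosed

variable {K : ℝ≥0} {M : ℝ} {u : ℝ → ℝ → ℝ} {U : ℝ × ℝ → ℝ} {c : ℝ}

/-- Existence: a pointwise limit, along an ultrafilter, of solutions with difference quotients. -/
theorem IsOleinikPotential.exists_isFilippovSolution (hU : IsOleinikPotential K M u U) (c : ℝ)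
    {s : ℝ} (hs : 0 ≤ s) (x : ℝ) :
    ∃ ξ, IsFilippovSolution (particleVelocity burgersFlux u c) s x ξ := by
  let h : ℕ → ℝ := fun n => 1 / ((n : ℝ) + 1)
  have hh : ∀ n, 0 < h n := fun n => by positivity
  choose β hβ0 hβL hβ using fun n : ℕ =>
    exists_solution_differenceVelocity (c := c) hU.lipschitz (hh n) s x n n.cast_nonneg
  set Λ := ((K + |c|) / 2).toNNReal
  let l : Filter ℕ := hyperfilter ℕ
  have hl : l ≤ atTop := Nat.hyperfilter_le_atTop
  have hlim : Tendsto h l (𝓝 0) := tendsto_one_div_add_atTop_nhds_zero_nat.mono_left hl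
  have hconv : ∀ t, ∃ y, Tendsto (fun n => β n t) l (𝓝 y) := by
    intro t
    obtain ⟨y, -, hy⟩ := (isCompact_closedBall x (Λ * dist t s)).ultrafilter_le_nhds
      ((hyperfilter ℕ).map fun n => β n t) (by
        rw [le_principal_iff]
        refine Eventually.of_forall (f := l) fun n => ?_
        have := (hβL n).dist_le_mul t s
        rwa [hβ0] at this)
    exact ⟨y, hy⟩
  choose ξ hξ using hconv
  have hξL : LipschitzWith Λ ξ := LipschitzWith.of_dist_le_mul fun t r =>
    le_of_tendsto ((hξ t).dist (hξ r)) (Eventually.of_forall fun n => (hβL n).dist_le_mul t r)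
  refine ⟨ξ, tendsto_nhds_unique (hξ s) (by simp only [hβ0]; exact tendsto_const_nhds),
    fun T _ => hξL.lipschitzOnWith.absolutelyContinuousOnInterval, ?_⟩
  filter_upwards [ae_restrict_of_ae hξL.ae_differentiableAt_real,
    ae_restrict_of_ae_restrict_of_subset (Ioi_subset_Ioi hs) hU.ae_hasDerivAt,
    ae_restrict_mem measurableSet_Ioi] with t h1 h2 h3
  have ht : 0 < t := hs.trans_lt h3
  have hode : ∀ᶠ n in l, ∀ τ ∈ Ico t (t + 1),
      HasDerivAt (β n) (differenceVelocity U c (h n) τ (β n τ)) τ := by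
    obtain ⟨N, hN⟩ := exists_nat_gt (t + 1 - s)
    filter_upwards [hl (eventually_ge_atTop N)] with n hn τ hτ
    have h4 : (N : ℝ) ≤ n := Nat.cast_le.2 hn
    exact hβ n τ ⟨(mem_Ioi.1 h3).trans_le hτ.1, by linarith [hτ.2]⟩
  -- a nonempty interval contains many points of differentiability of `U(·, t)`
  have hfreq : ∀ {a b δ : ℝ} {q : ℝ → Prop}, a < b → Ioo a b ⊆ Ioo (ξ t - δ) (ξ t + δ) →
      (∀ y ∈ Ioo a b, HasDerivAt (fun x => U (x, t)) (u y t) y → q y) →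
      ∃ᵐ y ∂(volume.restrict (Ioo (ξ t - δ) (ξ t + δ))), q y := by
    intro a b δ q hab hsub hq hnot
    have h4 := ae_restrict_of_ae_restrict_of_subset hsub hnot
    have h5 : ∀ᵐ y ∂(volume.restrict (Ioo a b)), False := by
      filter_upwards [h4, ae_restrict_of_ae h2, ae_restrict_mem measurableSet_Ioo] with y h6 h7 h8
      exact h6 (hq y h8 h7)
    rw [eventually_false_iff_eq_bot, ae_eq_bot, Measure.restrict_eq_zero, Real.volume_Ioo] at h5
    exact (ENNReal.ofReal_pos.2 (sub_pos.2 hab)).ne' h5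
  refine ⟨h1, lowerEnvelope_le fun δ hδ r hr => ?_, le_upperEnvelope fun δ hδ r hr => ?_⟩
  · set e := min δ (t * (r - deriv ξ t)) with he
    have he0 : 0 < e := lt_min hδ (mul_pos ht (sub_pos.2 hr))
    refine hfreq (a := ξ t) (b := ξ t + e) (by linarith) (fun y hy => ⟨by linarith [hy.1],
      by linarith [hy.2, min_le_left δ (t * (r - deriv ξ t))]⟩) fun y hy hd => ?_
    have h4 := le_two_mul_deriv_sub hU.lipschitz hU.concaveOn hh hlim hβL hξ ht
      (by linarith : t < t + 1) hode h1.hasDerivAt hy.1 hd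
    have h5 : (y - ξ t) / t ≤ r - deriv ξ t := by
      rw [div_le_iff₀ ht]
      linarith [hy.2, min_le_right δ (t * (r - deriv ξ t))]
    rw [particleVelocity_burgersFlux]
    linarith
  · set e := min δ (t * (deriv ξ t - r)) with he
    have he0 : 0 < e := lt_min hδ (mul_pos ht (sub_pos.2 hr))
    refine hfreq (a := ξ t - e) (b := ξ t) (by linarith) (fun y hy =>
      ⟨by linarith [hy.1, min_le_left δ (t * (deriv ξ t - r))], by linarith [hy.2]⟩)
      fun y hy hd => ?_
    have h4 := two_mul_deriv_sub_le hU.lipschitz hU.concaveOn hh hlim hβL hξ ht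
      (by linarith : t < t + 1) hode h1.hasDerivAt hy.2 hd
    have h5 : (ξ t - y) / t ≤ deriv ξ t - r := by
      rw [div_le_iff₀ ht]
      linarith [hy.1, min_le_right δ (t * (deriv ξ t - r))]
    rw [particleVelocity_burgersFlux]
    linarith

/-- Two solutions with different starting times are compared at the later of the two. -/
theorem IsOleinikPotential.flow_dist_le (hU : IsOleinikPotential K M u U)
    {s s' x x' t t' : ℝ} {ξ ζ : ℝ → ℝ} (hs : 0 ≤ s) (hs' : 0 ≤ s') (ht : s ≤ t) (ht' : s' ≤ t')
    (hξ : IsFilippovSolution (particleVelocity burgersFlux u c) s x ξ)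
    (hζ : IsFilippovSolution (particleVelocity burgersFlux u c) s' x' ζ) :
    |ζ t' - ξ t| ≤ (M + |c|) / 2 * |t' - t| + ((|x' - x| + (M + |c|) / 2 * |s' - s|)
      + 2 * √(M * (|x' - x| + (M + |c|) / 2 * |s' - s|) * max t t')) := by
  have hM := hU.bound_nonneg
  set Λ := (M + |c|) / 2 with hΛ
  have hΛ0 : 0 ≤ Λ := by positivity
  set σ := max s s' with hσ
  set T := max t t' with hT
  have hσT : σ ≤ T := max_le_max ht ht'
  have hσ0 : 0 ≤ σ := hs.trans (le_max_left _ _)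
  have h1 := hU.stability hσ0 (hξ.mono (le_max_left s s')) (hζ.mono (le_max_right s s')) hσT
  have h2 : |ξ σ - ξ s| ≤ Λ * (σ - s) :=
    hU.abs_sub_le_of_isFilippovSolution hs hξ le_rfl (le_max_left s s')
  have h3 : |ζ σ - ζ s'| ≤ Λ * (σ - s') :=
    hU.abs_sub_le_of_isFilippovSolution hs' hζ le_rfl (le_max_right s s')
  have h4 : |ξ T - ξ t| ≤ Λ * (T - t) :=
    hU.abs_sub_le_of_isFilippovSolution hs hξ ht (le_max_left t t')
  have h5 : |ζ T - ζ t'| ≤ Λ * (T - t') :=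
    hU.abs_sub_le_of_isFilippovSolution hs' hζ ht' (le_max_right t t')
  rw [hξ.initial] at h2
  rw [hζ.initial] at h3
  have hmax : ∀ a b : ℝ, Λ * (max a b - a) + Λ * (max a b - b) = Λ * |b - a| := by
    intro a b
    rcases le_total a b with h | h
    · rw [max_eq_right h, abs_of_nonneg (by linarith)]
      ring
    · rw [max_eq_left h, abs_of_nonpos (by linarith)]
      ring
  have h6 : Λ * (σ - s) + Λ * (σ - s') = Λ * |s' - s| := hmax s s'
  have h7 : Λ * (T - t) + Λ * (T - t') = Λ * |t' - t| := hmax t t'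
  have h8 : |ζ σ - ξ σ| ≤ |x' - x| + Λ * |s' - s| := by
    have h9 : ζ σ - ξ σ = (ζ σ - x') + (x' - x) - (ξ σ - x) := by ring
    rw [h9]
    refine (abs_sub _ _).trans ?_
    have := abs_add_le (ζ σ - x') (x' - x)
    linarith
  have h9 : √(M * |ζ σ - ξ σ| * T) ≤ √(M * (|x' - x| + Λ * |s' - s|) * T) := by
    have : 0 ≤ T := hσ0.trans hσT
    gcongr
  have h10 : ζ t' - ξ t = (ζ T - ξ T) - (ζ T - ζ t') + (ξ T - ξ t) := by ring
  rw [h10]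
  have h11 := abs_add_le ((ζ T - ξ T) - (ζ T - ζ t')) (ξ T - ξ t)
  have h12 := abs_sub (ζ T - ξ T) (ζ T - ζ t')
  linarith

theorem IsOleinikPotential.isFilippovWellPosed (hU : IsOleinikPotential K M u U) (c : ℝ) :
    IsFilippovWellPosed (particleVelocity burgersFlux u c) where
  exists_solution s x hs := hU.exists_isFilippovSolution c hs x
  unique s x hs ξ ζ hξ hζ t ht := by
    have h1 := hU.stability hs hξ hζ (mem_Ici.1 ht)
    simp only [sub_self, abs_zero, mul_zero, zero_mul, Real.sqrt_zero, add_zero] at h1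
    linarith [abs_nonpos_iff.1 h1]
  continuous_flow X hX := by
    rintro ⟨t, x, s⟩ ⟨hs, hst⟩
    rw [ContinuousWithinAt, tendsto_iff_dist_tendsto_zero]
    let F : ℝ × ℝ × ℝ → ℝ := fun p =>
      (M + |c|) / 2 * |p.1 - t| + ((|p.2.1 - x| + (M + |c|) / 2 * |p.2.2 - s|)
        + 2 * √(M * (|p.2.1 - x| + (M + |c|) / 2 * |p.2.2 - s|) * max t p.1))
    have hF : Tendsto F (𝓝[{p | 0 ≤ p.2.2 ∧ p.2.2 ≤ p.1}] (t, x, s)) (𝓝 0) := by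
      have h1 : F (t, x, s) = 0 := by simp [F]
      rw [← h1]
      exact ((by fun_prop : Continuous F).tendsto _).mono_left nhdsWithin_le_nhds
    refine squeeze_zero' (Eventually.of_forall fun _ => dist_nonneg) ?_ hF
    filter_upwards [self_mem_nhdsWithin] with p hp
    rw [Real.dist_eq]
    exact hU.flow_dist_le hs hp.1 hst hp.2 (hX s x hs) (hX p.2.2 p.2.1 hp.1)

end WellPosed

theorem theorem1p2 (u₀ : ℝ → ℝ) (hu₀ : MemLp u₀ ∞ volume)
    (u : ℝ → ℝ → ℝ) (hu : IsEntropySolution burgersFlux u₀ u) (c : ℝ) :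
    IsFilippovWellPosed (particleVelocity burgersFlux u c) ∧
    ∀ (x y : ℝ) (ξ ζ : ℝ → ℝ),
      IsFilippovSolution (particleVelocity burgersFlux u c) 0 x ξ →
      IsFilippovSolution (particleVelocity burgersFlux u c) 0 y ζ →
      ∀ t : ℝ, 0 ≤ t →
        |ζ t - ξ t| ≤ |y - x| +
          2 * Real.sqrt ((eLpNorm u₀ ∞ volume).toReal * |y - x| * t) := by
  obtain ⟨K, U, hU⟩ := hu.exists_isOleinikPotential hu₀
  exact ⟨hU.isFilippovWellPosed c, fun x y ξ ζ hξ hζ t ht => hU.stability le_rfl hξ hζ ht⟩
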